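/- For integers $a,b \ge 2$, let $\theta_{a,b}$ denote the graph consisting of $a$ internally vertex-disjoint paths of length $b$ (that is, with $b$ edges each), all having the same two endpoints. A copy of $\theta_{a,b}$ in a graph $G$ is a (not necessarily induced) subgraph of $G$ isomorphic to $\theta_{a,b}$. Theorem. For all integers $a, b \ge 2$ there exist constants $C > 0$ and $c > 0$, depending only on $a$ and $b$, such that every finite simple graph $G$ with $n \ge 1$ vertices and $m \ge C\, n^{1+1/b}$ edges contains at least $$c\, m^{ab}\, n^{2-a(b+1)}$$ copies of $\theta_{a,b}$. -/

import Mathlib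

/-- The vertex set of the theta graph: two endpoints `inl 0`, `inl 1`, and for each of the `a`
paths its `b - 1` internal vertices. -/
abbrev ThetaVertex (a b : ℕ) : Type := Fin 2 ⊕ (Fin a × Fin (b - 1))

/-- The `j`-th vertex, `0 ≤ j ≤ b`, of the `i`-th path: the endpoint `inl 0` for `j = 0`,
an internal vertex of the path for `0 < j < b`, and the endpoint `inl 1` for `j = b`. -/
def thetaPathVertex (a b : ℕ) (i : Fin a) (j : ℕ) : ThetaVertex a b :=
  if j = 0 then Sum.inl 0
  else if h : j - 1 < b - 1 then Sum.inr (i, ⟨j - 1, h⟩)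
  else Sum.inl 1

/-- The theta graph: `a` internally vertex-disjoint paths of length `b`, all joining the same two
endpoints. Its edges are the pairs of consecutive vertices of the paths. -/
def thetaGraph (a b : ℕ) : SimpleGraph (ThetaVertex a b) :=
  SimpleGraph.fromRel fun x y =>
    ∃ (i : Fin a) (j : Fin b), x = thetaPathVertex a b i j ∧ y = thetaPathVertex a b i (j + 1)

/-!
Choosing the edges of `G` at random, it is enough to find a quadratic number of theta graphs in
graphs with `C n ^ (1 + 1 / b)` edges (`mul_pow_le_labelledCopyCount`). For this, walks are weighted
by the stationary measure of the simple random walk. Since it is invariant under deleting the first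
or the last vertex, no regularity of the graph is needed: a property of a positive proportion of
the segments of long walks holds for a positive proportion of the walks of the shorter length.

Let `δ` be a small multiple of the average degree. A walk is light if all its degrees are at least
`δ`, its vertices are distinct, and the walks linking the ends of each of its segments, of length
`ℓ` say, have total weight at most about `δ ^ (1 - ℓ)`. Light walks of length `b` have total weight
at most about `n ^ 2 * δ ^ (1 - b)`, which is small compared with the number of edges. Hence for
some `ℓ ≤ b` a positive proportion of the walks of length `ℓ` are heavy: they are light except that
their ends are linked by too many such walks (`exists_heavyMass`). Among the walks linking the ends
of a heavy walk, only a small part passes through a given interior vertex, because both segments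
cut off by this vertex are light (`sum_through_le`). After a cleaning step, this gives a robust
family of paths of length `ℓ`: those joining two given ends cannot be blocked by boundedly many
vertices, and their last edge can be chosen in about `δ` ways (`exists_isRobust`).

A path of the family is prolonged to length `b` by going back and forth along last edges of paths
with the same initial vertex `u`. A step back to the terminal vertex of a path of the family
multiplies the number of prolonged paths by about `δ`, and a step away from it multiplies by about
`δ` the number of prolonged paths between two given ends that avoid a given bounded set, since such
a path can be retraced from its end to `u` with `δ` choices at this step
(`IsRobust.exists_isLegFamily`). A theta graph is now built from a first leg, a second leg with the
same ends, and further legs whose existence is all that matters. The product of the numbers of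
choices for the first two legs is of order `n * δ ^ b`, hence at least of order `n ^ 2`.
-/

namespace ThetaSupersaturation

open Finset
open scoped Classical

/-! ### The stationary random walk -/

section

variable {V : Type*} [Fintype V]

/-- The degree of a vertex, as a real number. -/
noncomputable def vdeg (G : SimpleGraph V) (u : V) : ℝ := ∑ v, if G.Adj u v then 1 else 0

/-- The transition probability of the simple random walk. -/
noncomputable def step (G : SimpleGraph V) (u v : V) : ℝ := if G.Adj u v then (vdeg G u)⁻¹ else 0

/-- The stationary measure of the simple random walk on sequences of `ℓ + 1` vertices, normalised
to have total mass `∑ v, vdeg G v`. It vanishes outside the walks of `G`. -/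
noncomputable def walkWeight (G : SimpleGraph V) {ℓ : ℕ} (x : Fin (ℓ + 1) → V) : ℝ :=
  vdeg G (x 0) * ∏ i : Fin ℓ, step G (x i.castSucc) (x i.succ)

variable (G : SimpleGraph V)

lemma vdeg_nonneg (u : V) : 0 ≤ vdeg G u :=
  Finset.sum_nonneg fun _ _ => by split_ifs <;> norm_num

lemma step_nonneg (u v : V) : 0 ≤ step G u v := by
  unfold step; split_ifs
  · exact inv_nonneg.2 (vdeg_nonneg G u)
  · exact le_rfl

lemma step_le_inv (u v : V) : step G u v ≤ (vdeg G u)⁻¹ := by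
  unfold step; split_ifs
  · exact le_rfl
  · exact inv_nonneg.2 (vdeg_nonneg G u)

variable {G}

lemma vdeg_pos_of_adj {u v : V} (h : G.Adj u v) : 0 < vdeg G u := by
  have : (1 : ℝ) ≤ vdeg G u := by
    have := Finset.single_le_sum (f := fun v => if G.Adj u v then (1 : ℝ) else 0)
      (fun _ _ => by split_ifs <;> norm_num) (Finset.mem_univ v)
    simpa [h, vdeg] using this
  linarith

variable (G)

lemma sum_step {u : V} (h : vdeg G u ≠ 0) : ∑ v, step G u v = 1 := by
  have : ∀ v, step G u v = (vdeg G u)⁻¹ * (if G.Adj u v then 1 else 0) := by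
    intro v; unfold step; split_ifs <;> simp
  simp_rw [this]
  rw [← Finset.mul_sum]
  exact inv_mul_cancel₀ h

lemma vdeg_mul_step (u v : V) : vdeg G u * step G u v = if G.Adj u v then 1 else 0 := by
  unfold step; split_ifs with h
  · exact mul_inv_cancel₀ (vdeg_pos_of_adj h).ne'
  · simp

/-- The random walk is reversible. -/
lemma vdeg_mul_step_comm (u v : V) : vdeg G u * step G u v = vdeg G v * step G v u := by
  simp [vdeg_mul_step, G.adj_comm]

lemma walkWeight_nonneg {ℓ : ℕ} (x : Fin (ℓ + 1) → V) : 0 ≤ walkWeight G x :=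
  mul_nonneg (vdeg_nonneg G _) (Finset.prod_nonneg fun _ _ => step_nonneg G _ _)

lemma walkWeight_zero (x : Fin 1 → V) : walkWeight G x = vdeg G (x 0) := by
  simp [walkWeight]

lemma walkWeight_le_one (x : Fin 2 → V) : walkWeight G x ≤ 1 := by
  have h : walkWeight G x = vdeg G (x 0) * step G (x 0) (x 1) := by
    simp [walkWeight]
  rw [h, vdeg_mul_step]
  split_ifs <;> norm_num

lemma walkWeight_init {ℓ : ℕ} (x : Fin (ℓ + 2) → V) :
    walkWeight G x = walkWeight G (Fin.init x : Fin (ℓ + 1) → V) *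
      step G (x (Fin.last ℓ).castSucc) (x (Fin.last (ℓ + 1))) := by
  unfold walkWeight
  rw [Fin.prod_univ_castSucc, ← mul_assoc]
  rfl

lemma walkWeight_tail {ℓ : ℕ} (x : Fin (ℓ + 2) → V) :
    walkWeight G x = walkWeight G (Fin.tail x : Fin (ℓ + 1) → V) * step G (x 1) (x 0) := by
  unfold walkWeight
  rw [Fin.prod_univ_succ, ← mul_assoc]
  have := vdeg_mul_step_comm G (x 0) (x 1)
  simp only [Fin.castSucc_zero, Fin.succ_zero_eq_one] at *
  rw [this]
  simp only [Fin.tail, Fin.succ_zero_eq_one]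
  rw [mul_right_comm]
  rfl

variable {G}

lemma adj_of_walkWeight_ne_zero {ℓ : ℕ} {x : Fin (ℓ + 1) → V} (h : walkWeight G x ≠ 0)
    (i : Fin ℓ) : G.Adj (x i.castSucc) (x i.succ) := by
  by_contra hc
  apply h
  unfold walkWeight
  rw [Finset.prod_eq_zero (Finset.mem_univ i) (by simp [step, hc]), mul_zero]

lemma walkWeight_eq_zero {ℓ : ℕ} {x : Fin (ℓ + 1) → V} (h : vdeg G (x (Fin.last ℓ)) = 0) :
    walkWeight G x = 0 := by
  cases ℓ with
  | zero => rw [walkWeight_zero]; exact h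
  | succ ℓ =>
    by_contra hc
    have := adj_of_walkWeight_ne_zero hc (Fin.last ℓ)
    exact (vdeg_pos_of_adj this.symm).ne' h

variable (G)

lemma sum_walkWeight_snoc {ℓ : ℕ} (y : Fin (ℓ + 1) → V) :
    ∑ v, walkWeight G (Fin.snoc y v : Fin (ℓ + 2) → V) = walkWeight G y := by
  simp_rw [walkWeight_init G (Fin.snoc y _), Fin.init_snoc, Fin.snoc_castSucc, Fin.snoc_last]
  rw [← Finset.mul_sum]
  by_cases h : vdeg G (y (Fin.last ℓ)) = 0
  · simp [walkWeight_eq_zero h]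
  · rw [sum_step G h, mul_one]

lemma sum_walkWeight_cons {ℓ : ℕ} (y : Fin (ℓ + 1) → V) :
    ∑ v, walkWeight G (Fin.cons v y : Fin (ℓ + 2) → V) = walkWeight G y := by
  have h1 : ∀ v, (Fin.cons v y : Fin (ℓ + 2) → V) 1 = y 0 := fun v => rfl
  simp_rw [walkWeight_tail G (Fin.cons _ y), Fin.tail_cons, Fin.cons_zero, h1]
  rw [← Finset.mul_sum]
  by_cases h : vdeg G (y 0) = 0
  · simp [walkWeight, h]
  · rw [sum_step G h, mul_one]

lemma sum_eq_sum_snoc {M : Type*} [AddCommMonoid M] {ℓ : ℕ} (f : (Fin (ℓ + 2) → V) → M) :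
    ∑ x, f x = ∑ y : Fin (ℓ + 1) → V, ∑ v, f (Fin.snoc y v) := by
  rw [← (Fin.snocEquiv fun _ : Fin (ℓ + 2) => V).sum_comp, Fintype.sum_prod_type_right]
  rfl

lemma sum_eq_sum_cons {M : Type*} [AddCommMonoid M] {ℓ : ℕ} (f : (Fin (ℓ + 2) → V) → M) :
    ∑ x, f x = ∑ y : Fin (ℓ + 1) → V, ∑ v, f (Fin.cons v y) := by
  rw [← (Fin.consEquiv fun _ : Fin (ℓ + 2) => V).sum_comp, Fintype.sum_prod_type_right]
  rfl

/-- Deleting the last vertex of a stationary walk leaves a stationary walk. -/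
lemma sum_init_mul_walkWeight {ℓ : ℕ} (f : (Fin (ℓ + 1) → V) → ℝ) :
    ∑ x : Fin (ℓ + 2) → V, f (Fin.init x) * walkWeight G x = ∑ y, f y * walkWeight G y := by
  rw [sum_eq_sum_snoc]
  refine Finset.sum_congr rfl fun y _ => ?_
  simp_rw [Fin.init_snoc]
  rw [← Finset.mul_sum, sum_walkWeight_snoc]

/-- Deleting the first vertex of a stationary walk leaves a stationary walk. -/
lemma sum_tail_mul_walkWeight {ℓ : ℕ} (f : (Fin (ℓ + 1) → V) → ℝ) :
    ∑ x : Fin (ℓ + 2) → V, f (Fin.tail x) * walkWeight G x = ∑ y, f y * walkWeight G y := by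
  rw [sum_eq_sum_cons]
  refine Finset.sum_congr rfl fun y _ => ?_
  simp_rw [Fin.tail_cons]
  rw [← Finset.mul_sum, sum_walkWeight_cons]

lemma sum_walkWeight (ℓ : ℕ) : ∑ x : Fin (ℓ + 1) → V, walkWeight G x = ∑ v, vdeg G v := by
  induction ℓ with
  | zero =>
    rw [← (Equiv.funUnique (Fin 1) V).symm.sum_comp]
    simp [walkWeight_zero]
  | succ ℓ ih =>
    have := sum_init_mul_walkWeight G (ℓ := ℓ) (fun _ => 1)
    simpa [ih] using this

/-- The segment of length `q` of a sequence, starting at position `p`. -/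
def seg {ℓ : ℕ} (x : Fin (ℓ + 1) → V) (p q : ℕ) (h : p + q ≤ ℓ) : Fin (q + 1) → V :=
  fun i => x ⟨p + i, by omega⟩

/-- Cutting a walk at an interior vertex. -/
lemma walkWeight_mul_vdeg {q r : ℕ} (x : Fin (q + r + 1) → V) :
    walkWeight G x * vdeg G (x ⟨q, by omega⟩) =
      walkWeight G (seg x 0 q (by omega)) * walkWeight G (seg x q r le_rfl) := by
  unfold walkWeight
  rw [Fin.prod_univ_add]
  have h1 : ∏ i : Fin q, step G (x (Fin.castAdd r i).castSucc) (x (Fin.castAdd r i).succ) =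
      ∏ i : Fin q, step G (seg x 0 q (by omega) i.castSucc) (seg x 0 q (by omega) i.succ) := by
    refine Finset.prod_congr rfl fun i _ => ?_
    unfold seg
    congr 2 <;> ext <;> simp
  have h2 : ∏ i : Fin r, step G (x (Fin.natAdd q i).castSucc) (x (Fin.natAdd q i).succ) =
      ∏ i : Fin r, step G (seg x q r le_rfl i.castSucc) (seg x q r le_rfl i.succ) := by
    refine Finset.prod_congr rfl fun i _ => ?_
    unfold seg
    congr 2
  rw [h1, h2]
  have h3 : seg x q r le_rfl 0 = x ⟨q, by omega⟩ := by simp [seg]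
  have h4 : seg x 0 q (by omega) 0 = x 0 := by simp [seg]
  rw [h3, h4]
  ring

end

/-! ### Light and heavy walks -/

section

variable {V : Type*} [Fintype V]

/-- A sequence extends the predicate `Q` if deleting its first or its last vertex leaves a sequence
satisfying `Q`, and its two ends are distinct. -/
def Extends {ℓ : ℕ} (Q : (Fin (ℓ + 1) → V) → Prop) (x : Fin (ℓ + 2) → V) : Prop :=
  Q (Fin.init x) ∧ Q (Fin.tail x) ∧ x 0 ≠ x (Fin.last _)

/-- The total weight of the walks from `u` to `v` that extend `Q`. -/
noncomputable def linkMass (G : SimpleGraph V) {ℓ : ℕ} (Q : (Fin (ℓ + 1) → V) → Prop)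
    (u v : V) : ℝ :=
  ∑ y : Fin (ℓ + 2) → V with Extends Q y ∧ y 0 = u ∧ y (Fin.last _) = v, walkWeight G y

/-- The threshold above which the walks of length `ℓ` between two vertices count as heavy: up to a
constant depending on `ℓ` only, it is `δ ^ (1 - ℓ)`. The powers of `T` make the products
`threshold q * threshold r / δ` much smaller than `threshold (q + r)`. -/
noncomputable def threshold (δ T : ℝ) (ℓ : ℕ) : ℝ := (T ^ 3 / δ) ^ ℓ * (δ / T ^ 2)

/-- The light walks: all vertices have degree at least `δ`, the vertices are distinct, and no
segment has heavily linked ends. -/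
def IsLight (G : SimpleGraph V) (δ T : ℝ) : (ℓ : ℕ) → (Fin (ℓ + 1) → V) → Prop
  | 0, x => δ ≤ vdeg G (x 0)
  | ℓ + 1, x => Extends (IsLight G δ T ℓ) x ∧
      linkMass G (IsLight G δ T ℓ) (x 0) (x (Fin.last _)) ≤ threshold δ T (ℓ + 1)

/-- A heavy walk is not light, although both walks obtained by deleting an end vertex are. -/
def IsHeavy (G : SimpleGraph V) (δ T : ℝ) {ℓ : ℕ} (x : Fin (ℓ + 2) → V) : Prop :=
  Extends (IsLight G δ T ℓ) x ∧
    threshold δ T (ℓ + 1) < linkMass G (IsLight G δ T ℓ) (x 0) (x (Fin.last _))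

variable {G : SimpleGraph V} {δ T : ℝ}

lemma threshold_pos (hδ : 0 < δ) (hT : 0 < T) (ℓ : ℕ) : 0 < threshold δ T ℓ := by
  unfold threshold; positivity

lemma threshold_mul (hδ : 0 < δ) (hT : 0 < T) (q r : ℕ) :
    threshold δ T q * threshold δ T r / δ = threshold δ T (q + r) / T ^ 2 := by
  unfold threshold
  rw [pow_add]
  field_simp

lemma IsLight.seg {ℓ : ℕ} {x : Fin (ℓ + 1) → V} (hx : IsLight G δ T ℓ x) (p q : ℕ)
    (h : p + q ≤ ℓ) : IsLight G δ T q (seg x p q h) := by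
  induction ℓ generalizing p q with
  | zero =>
    obtain rfl : p = 0 := by omega
    obtain rfl : q = 0 := by omega
    exact hx
  | succ ℓ ih =>
    rcases Nat.eq_zero_or_pos p with rfl | hp
    · rcases Nat.lt_or_ge q (ℓ + 1) with hq | hq
      · exact ih (x := Fin.init x) hx.1.1 0 q (by omega)
      · obtain rfl : q = ℓ + 1 := by omega
        convert hx using 1
        ext i
        simp [ThetaSupersaturation.seg]
    · have := ih (x := Fin.tail x) hx.1.2.1 (p - 1) q (by omega)
      convert this using 1
      ext i
      simp only [ThetaSupersaturation.seg, Fin.tail]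
      congr 1
      ext
      simp
      omega

lemma IsLight.le_vdeg {ℓ : ℕ} {x : Fin (ℓ + 1) → V} (hx : IsLight G δ T ℓ x) (i : Fin (ℓ + 1)) :
    δ ≤ vdeg G (x i) := by
  have := hx.seg i 0 (by omega)
  simpa [IsLight, ThetaSupersaturation.seg] using this

lemma Extends.le_vdeg {ℓ : ℕ} {x : Fin (ℓ + 2) → V} (hx : Extends (IsLight G δ T ℓ) x)
    (i : Fin (ℓ + 2)) : δ ≤ vdeg G (x i) := by
  induction i using Fin.lastCases with
  | last => exact hx.2.1.le_vdeg (Fin.last ℓ)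
  | cast i => exact hx.1.le_vdeg i

lemma IsLight.ne {ℓ : ℕ} {x : Fin (ℓ + 1) → V} (hx : IsLight G δ T ℓ x) {i j : ℕ}
    (hij : i < j) (hj : j < ℓ + 1) : x ⟨i, by omega⟩ ≠ x ⟨j, hj⟩ := by
  obtain ⟨k, rfl⟩ : ∃ k, j = i + (k + 1) := ⟨j - i - 1, by omega⟩
  have := (hx.seg i (k + 1) (by omega)).1.2.2
  simpa [ThetaSupersaturation.seg] using this

lemma IsLight.injective {ℓ : ℕ} {x : Fin (ℓ + 1) → V} (hx : IsLight G δ T ℓ x) :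
    Function.Injective x := by
  intro i j h
  by_contra hne
  rcases lt_or_gt_of_ne hne with hlt | hlt
  · exact hx.ne hlt j.2 h
  · exact hx.ne hlt i.2 h.symm

lemma Extends.injective {ℓ : ℕ} {x : Fin (ℓ + 2) → V} (hx : Extends (IsLight G δ T ℓ) x) :
    Function.Injective x := by
  have key : ∀ i : Fin (ℓ + 1), x i.castSucc ≠ x (Fin.last _) := by
    intro i
    induction i using Fin.cases with
    | zero => exact hx.2.2
    | succ i =>
      intro h
      have := hx.2.1.injective (a₁ := i.castSucc) (a₂ := Fin.last ℓ) h
      exact (Fin.castSucc_lt_last i).ne this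
  intro i j h
  induction i using Fin.lastCases with
  | last =>
    induction j using Fin.lastCases with
    | last => rfl
    | cast j => exact absurd h.symm (key j)
  | cast i =>
    induction j using Fin.lastCases with
    | last => exact absurd h (key i)
    | cast j => exact congrArg _ (hx.1.injective h)

/-- A walk of length `ℓ` whose interior vertices have degree at least `δ` has weight at most
`δ ^ (1 - ℓ)`. -/
lemma walkWeight_le_of_isLight (hδ : 0 < δ) {ℓ : ℕ} {x : Fin (ℓ + 2) → V}
    (hx : IsLight G δ T ℓ (Fin.init x)) : walkWeight G x ≤ (δ⁻¹) ^ ℓ := by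
  induction ℓ with
  | zero =>
    simpa using walkWeight_le_one G x
  | succ ℓ ih =>
    rw [walkWeight_init, pow_succ]
    refine mul_le_mul (ih hx.1.1) ?_ (step_nonneg _ _ _) (by positivity)
    refine (step_le_inv _ _ _).trans ?_
    exact inv_anti₀ hδ (hx.le_vdeg (Fin.last _))

/-- The light walks between two given vertices have total weight at most the threshold. -/
lemma sum_isLight_le (hδ : 0 < δ) (hT : 0 < T) (ℓ : ℕ) (u v : V) :
    ∑ y : Fin (ℓ + 2) → V with IsLight G δ T (ℓ + 1) y ∧ y 0 = u ∧ y (Fin.last _) = v,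
      walkWeight G y ≤ threshold δ T (ℓ + 1) := by
  by_cases h : ∃ y : Fin (ℓ + 2) → V, IsLight G δ T (ℓ + 1) y ∧ y 0 = u ∧ y (Fin.last _) = v
  · obtain ⟨y, hy, rfl, rfl⟩ := h
    refine le_trans ?_ hy.2
    unfold linkMass
    refine Finset.sum_le_sum_of_subset_of_nonneg ?_ fun _ _ _ => walkWeight_nonneg _ _
    intro z
    simp only [Finset.mem_filter, Finset.mem_univ, true_and]
    exact fun hz => ⟨hz.1.1, hz.2⟩
  · rw [Finset.sum_eq_zero]
    · exact (threshold_pos hδ hT _).le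
    · intro y hy
      exact absurd ⟨y, (Finset.mem_filter.1 hy).2⟩ h

lemma sum_isLight_le_card_sq (hδ : 0 < δ) (hT : 0 < T) (ℓ : ℕ) :
    ∑ y : Fin (ℓ + 2) → V with IsLight G δ T (ℓ + 1) y, walkWeight G y ≤
      (Fintype.card V : ℝ) ^ 2 * threshold δ T (ℓ + 1) := by
  rw [← Finset.sum_fiberwise (g := fun y : Fin (ℓ + 2) → V => (y 0, y (Fin.last _)))]
  refine (Finset.sum_le_card_nsmul _ _ (threshold δ T (ℓ + 1)) ?_).trans (le_of_eq ?_)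
  · rintro ⟨u, v⟩ -
    refine le_trans (le_of_eq ?_) (sum_isLight_le (G := G) hδ hT ℓ u v)
    rw [Finset.filter_filter]
    simp [Prod.ext_iff]
  · simp [sq]

/-- The mass of the walks of length `ℓ` that are not light. -/
noncomputable def badMass (G : SimpleGraph V) (δ T : ℝ) (ℓ : ℕ) : ℝ :=
  ∑ x : Fin (ℓ + 1) → V with ¬ IsLight G δ T ℓ x, walkWeight G x

/-- The mass of the heavy walks of length `ℓ + 1`. -/
noncomputable def heavyMass (G : SimpleGraph V) (δ T : ℝ) (ℓ : ℕ) : ℝ :=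
  ∑ x : Fin (ℓ + 2) → V with IsHeavy G δ T x, walkWeight G x

lemma badMass_zero_le (hδ : 0 < δ) : badMass G δ T 0 ≤ Fintype.card V * δ := by
  unfold badMass
  refine (Finset.sum_le_card_nsmul _ _ δ ?_).trans ?_
  · intro x hx
    rw [walkWeight_zero]
    exact (not_le.1 (Finset.mem_filter.1 hx).2).le
  · rw [nsmul_eq_mul]
    gcongr
    refine (Finset.card_le_univ _).trans (le_of_eq ?_)
    simp

/-- Closing up a walk that is light without its last step has probability at most `δ⁻¹`. -/
lemma sum_closed_le (hδ : 0 < δ) (ℓ : ℕ) :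
    ∑ x : Fin (ℓ + 2) → V with IsLight G δ T ℓ (Fin.init x : Fin (ℓ + 1) → V) ∧
        x 0 = x (Fin.last (ℓ + 1)),
      walkWeight G x ≤ (∑ v, vdeg G v) * δ⁻¹ := by
  rw [Finset.sum_filter, sum_eq_sum_snoc, ← sum_walkWeight G ℓ, Finset.sum_mul]
  refine Finset.sum_le_sum fun y _ => ?_
  have h0 : ∀ v, (Fin.snoc y v : Fin (ℓ + 2) → V) 0 = y 0 := fun v => Fin.snoc_castSucc (i := 0) ..
  simp only [Fin.init_snoc, Fin.snoc_last, h0]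
  by_cases hy : IsLight G δ T ℓ y
  · simp only [hy, true_and, Finset.sum_ite_eq, Finset.mem_univ, if_true]
    rw [walkWeight_init, Fin.init_snoc, Fin.snoc_castSucc]
    refine mul_le_mul_of_nonneg_left ?_ (walkWeight_nonneg _ _)
    exact (step_le_inv _ _ _).trans (inv_anti₀ hδ (hy.le_vdeg _))
  · simp only [hy, false_and, if_false, Finset.sum_const_zero]
    exact mul_nonneg (walkWeight_nonneg _ _) (inv_nonneg.2 hδ.le)

/-- A walk fails to be light if it does so after deleting an end vertex, if it is closed, or if it
is heavy. -/
lemma badMass_succ_le (hδ : 0 < δ) (ℓ : ℕ) :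
    badMass G δ T (ℓ + 1) ≤
      2 * badMass G δ T ℓ + (∑ v, vdeg G v) * δ⁻¹ + heavyMass G δ T ℓ := by
  have h1 : ∑ x : Fin (ℓ + 2) → V, (if ¬ IsLight G δ T ℓ (Fin.init x) then 1 else 0) *
      walkWeight G x = badMass G δ T ℓ := by
    rw [sum_init_mul_walkWeight G (fun y => if ¬ IsLight G δ T ℓ y then 1 else 0)]
    simp only [badMass, Finset.sum_filter, ite_mul, one_mul, zero_mul]
  have h2 : ∑ x : Fin (ℓ + 2) → V, (if ¬ IsLight G δ T ℓ (Fin.tail x) then 1 else 0) *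
      walkWeight G x = badMass G δ T ℓ := by
    rw [sum_tail_mul_walkWeight G (fun y => if ¬ IsLight G δ T ℓ y then 1 else 0)]
    simp only [badMass, Finset.sum_filter, ite_mul, one_mul, zero_mul]
  have h3 := sum_closed_le (G := G) (T := T) hδ ℓ
  have h4 : badMass G δ T (ℓ + 1) ≤
      ∑ x : Fin (ℓ + 2) → V, (if ¬ IsLight G δ T ℓ (Fin.init x) then 1 else 0) * walkWeight G x +
      ∑ x : Fin (ℓ + 2) → V, (if ¬ IsLight G δ T ℓ (Fin.tail x) then 1 else 0) * walkWeight G x +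
      ∑ x : Fin (ℓ + 2) → V with IsLight G δ T ℓ (Fin.init x : Fin (ℓ + 1) → V) ∧
        x 0 = x (Fin.last (ℓ + 1)),
        walkWeight G x + heavyMass G δ T ℓ := by
    unfold badMass heavyMass
    rw [Finset.sum_filter, Finset.sum_filter, Finset.sum_filter, ← Finset.sum_add_distrib,
      ← Finset.sum_add_distrib, ← Finset.sum_add_distrib]
    refine Finset.sum_le_sum fun x _ => ?_
    have hw := walkWeight_nonneg G x
    simp only [IsLight, IsHeavy, Extends]
    by_cases c1 : IsLight G δ T ℓ (Fin.init x) <;> by_cases c2 : IsLight G δ T ℓ (Fin.tail x) <;>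
      by_cases c3 : x 0 = x (Fin.last (ℓ + 1)) <;>
      by_cases c4 : threshold δ T (ℓ + 1) <
        linkMass G (IsLight G δ T ℓ) (x 0) (x (Fin.last (ℓ + 1))) <;>
      simp [c1, c2, c3, c4, ← not_lt] <;> linarith
  linarith

/-- If `δ` is a small multiple of the average degree, but still large compared with
`n ^ (1 / b)`, then a positive proportion of the walks of some length at most `b` are heavy. -/
lemma exists_heavyMass {ε : ℝ} {b : ℕ} (hδ : 0 < δ) (hT : 0 < T) (hε : 4 ^ b * ε ≤ 1 / 2)
    (hb : 1 ≤ b) (hW : 0 < ∑ v, vdeg G v)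
    (h1 : Fintype.card V * δ ≤ ε * ∑ v, vdeg G v) (h2 : δ⁻¹ ≤ ε)
    (h3 : (Fintype.card V : ℝ) ^ 2 * threshold δ T b < (∑ v, vdeg G v) / 2) :
    ∃ ℓ < b, ε * ∑ v, vdeg G v ≤ heavyMass G δ T ℓ := by
  by_contra! hcon
  set W := ∑ v, vdeg G v with hWdef
  have hε0 : 0 < ε := lt_of_lt_of_le (inv_pos.2 hδ) h2
  have key : ∀ ℓ ≤ b, badMass G δ T ℓ ≤ 4 ^ ℓ * ε * W := by
    intro ℓ
    induction ℓ with
    | zero => intro _; simpa using (badMass_zero_le hδ).trans h1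
    | succ ℓ ih =>
      intro hℓ
      have i1 := ih (by omega)
      have i2 := hcon ℓ (by omega)
      have i3 := badMass_succ_le (G := G) (T := T) hδ ℓ
      have i4 : W * δ⁻¹ ≤ ε * W := by rw [mul_comm]; exact mul_le_mul_of_nonneg_right h2 hW.le
      have i5 : (1 : ℝ) ≤ 4 ^ ℓ := one_le_pow₀ (by norm_num)
      have i6 : ε * W ≤ 4 ^ ℓ * (ε * W) := le_mul_of_one_le_left (by positivity) i5
      rw [pow_succ]
      linarith
  obtain ⟨ℓ, rfl⟩ : ∃ ℓ, b = ℓ + 1 := ⟨b - 1, by omega⟩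
  have h5 := key (ℓ + 1) le_rfl
  have h6 := sum_isLight_le_card_sq (G := G) hδ hT ℓ
  have h7 := Finset.sum_filter_add_sum_filter_not Finset.univ
    (fun x : Fin (ℓ + 2) → V => IsLight G δ T (ℓ + 1) x) (walkWeight G)
  rw [sum_walkWeight] at h7
  have h8 : 4 ^ (ℓ + 1) * ε * W ≤ 1 / 2 * W := mul_le_mul_of_nonneg_right hε hW.le
  unfold badMass at h5
  linarith

/-- Walks of length one are never heavy. -/
lemma heavyMass_zero (hT : 1 ≤ T) (hδ : 0 < δ) : heavyMass G δ T 0 = 0 := by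
  unfold heavyMass
  refine Finset.sum_eq_zero fun x hx => ?_
  exfalso
  obtain ⟨h1, h2⟩ := (Finset.mem_filter.1 hx).2
  have h3 : linkMass G (IsLight G δ T 0) (x 0) (x (Fin.last _)) ≤ 1 := by
    unfold linkMass
    refine (Finset.sum_le_card_nsmul _ _ 1 fun y _ => walkWeight_le_one G y).trans ?_
    rw [nsmul_one]
    have : ({y : Fin 2 → V | Extends (IsLight G δ T 0) y ∧ y 0 = x 0 ∧
        y (Fin.last _) = x (Fin.last _)} : Finset _).card ≤ 1 := by
      refine Finset.card_le_one.2 fun y hy z hz => ?_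
      have hy := (Finset.mem_filter.1 hy).2.2
      have hz := (Finset.mem_filter.1 hz).2.2
      ext i
      fin_cases i
      · exact hy.1.trans hz.1.symm
      · exact hy.2.trans hz.2.symm
    exact_mod_cast this
  have h4 : threshold δ T 1 = T := by
    unfold threshold; field_simp
  simp only [zero_add, h4] at h2
  linarith

/-- For given ends, the walks through a given vertex at a given position make up only a small part
of the threshold, because both parts of such a walk are light. -/
lemma sum_through_le (hδ : 0 < δ) (hT : 0 < T) {ℓ : ℕ} (u v z : V) (i : Fin (ℓ + 2))
    (h0 : i ≠ 0) (hl : i ≠ Fin.last _) :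
    ∑ y : Fin (ℓ + 2) → V with (Extends (IsLight G δ T ℓ) y ∧ y 0 = u ∧ y (Fin.last _) = v) ∧
      y i = z, walkWeight G y ≤ threshold δ T (ℓ + 1) / T ^ 2 := by
  obtain ⟨q, r, hi, hℓ⟩ : ∃ q r : ℕ, (i : ℕ) = q + 1 ∧ ℓ = q + 1 + r := by
    have h1 : (i : ℕ) ≠ 0 := fun h => h0 (Fin.ext h)
    have h2 : (i : ℕ) ≠ ℓ + 1 := fun h => hl (Fin.ext h)
    exact ⟨i - 1, ℓ - i, by omega, by omega⟩
  subst hℓ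
  have hq : q + 1 < q + 1 + r + 2 := by omega
  obtain rfl : i = ⟨q + 1, hq⟩ := Fin.ext hi
  have hthr : threshold δ T (q + 1) * threshold δ T (r + 1) / δ =
    threshold δ T (q + 1 + r + 1) / T ^ 2 := threshold_mul hδ hT (q + 1) (r + 1)
  rw [← hthr]
  set A : Finset (Fin (q + 2) → V) :=
    {y | IsLight G δ T (q + 1) y ∧ y 0 = u ∧ y (Fin.last _) = z} with hA
  set B : Finset (Fin (r + 2) → V) :=
    {y | IsLight G δ T (r + 1) y ∧ y 0 = z ∧ y (Fin.last _) = v} with hB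
  have hAle := sum_isLight_le (G := G) hδ hT q u z
  have hBle := sum_isLight_le (G := G) hδ hT r z v
  set X : Finset (Fin (q + 1 + r + 2) → V) :=
    {y | (Extends (IsLight G δ T (q + 1 + r)) y ∧ y 0 = u ∧ y (Fin.last _) = v) ∧
      y ⟨q + 1, hq⟩ = z} with hX
  -- Cutting the walk at `z` embeds the sum into a product of two sums over light walks.
  let cut : (Fin (q + 1 + r + 2) → V) → (Fin (q + 2) → V) × (Fin (r + 2) → V) :=
    fun y => (seg y 0 (q + 1) (by omega), seg y (q + 1) (r + 1) (by omega))
  have hcut_inj : Function.Injective cut := by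
    intro y y' h
    simp only [cut, Prod.mk.injEq] at h
    ext ⟨j, hj⟩
    rcases Nat.lt_or_ge j (q + 2) with hjq | hjq
    · have := congrFun h.1 ⟨j, hjq⟩
      simpa [seg] using this
    · have := congrFun h.2 ⟨j - (q + 1), by omega⟩
      simp only [seg] at this
      convert this using 2 <;> (ext; simp; omega)
  have hmem : ∀ y ∈ X, cut y ∈ A ×ˢ B := by
    intro y hy
    obtain ⟨⟨hE, hyu, hyv⟩, hyz⟩ := (Finset.mem_filter.1 hy).2
    refine Finset.mem_product.2 ⟨Finset.mem_filter.2 ⟨Finset.mem_univ _, ?_, ?_, ?_⟩,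
      Finset.mem_filter.2 ⟨Finset.mem_univ _, ?_, ?_, ?_⟩⟩
    · exact hE.1.seg 0 (q + 1) (by omega)
    · simpa [cut, seg] using hyu
    · simpa [cut, seg] using hyz
    · have := hE.2.1.seg q (r + 1) (by omega)
      convert this using 1
      ext j
      simp only [cut, seg, Fin.tail]
      congr 1
      ext
      simp
      omega
    · simpa [cut, seg] using hyz
    · rw [← hyv]
      simp only [cut, seg]
      rfl
  have hweight : ∀ y ∈ X, walkWeight G y ≤
      walkWeight G (cut y).1 * walkWeight G (cut y).2 / δ := by
    intro y hy
    obtain ⟨⟨hE, hyu, hyv⟩, hyz⟩ := (Finset.mem_filter.1 hy).2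
    rw [le_div_iff₀ hδ]
    have := walkWeight_mul_vdeg G (q := q + 1) (r := r + 1) y
    refine le_trans ?_ this.le
    exact mul_le_mul_of_nonneg_left (hE.le_vdeg _) (walkWeight_nonneg _ _)
  calc ∑ y ∈ X, walkWeight G y
      ≤ ∑ y ∈ X, walkWeight G (cut y).1 * walkWeight G (cut y).2 / δ :=
        Finset.sum_le_sum hweight
    _ = ∑ p ∈ X.image cut, walkWeight G p.1 * walkWeight G p.2 / δ := by
        rw [Finset.sum_image fun y _ y' _ h => hcut_inj h]
    _ ≤ ∑ p ∈ A ×ˢ B, walkWeight G p.1 * walkWeight G p.2 / δ := by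
        refine Finset.sum_le_sum_of_subset_of_nonneg (Finset.image_subset_iff.2 hmem) ?_
        intro p _ _
        exact div_nonneg (mul_nonneg (walkWeight_nonneg _ _) (walkWeight_nonneg _ _)) hδ.le
    _ = (∑ y ∈ A, walkWeight G y) * (∑ y ∈ B, walkWeight G y) / δ := by
        rw [Finset.sum_product, Finset.sum_mul_sum, Finset.sum_div]
        simp_rw [Finset.sum_div]
    _ ≤ _ := by
        refine div_le_div_of_nonneg_right ?_ hδ.le
        exact mul_le_mul hAle hBle (Finset.sum_nonneg fun _ _ => walkWeight_nonneg _ _)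
          (threshold_pos hδ hT _).le

end

/-! ### Robust families of paths -/

section

section Cleaning

variable {X Y Z : Type*}

/-- The union bound. -/
lemma sum_le_sum_sum_of_cover (A : Finset X) (P : Finset Y) (R : Y → X → Prop) (w : X → ℝ)
    (hw : ∀ x, 0 ≤ w x) (hR : ∀ x ∈ A, ∃ p ∈ P, R p x) :
    ∑ x ∈ A, w x ≤ ∑ p ∈ P, ∑ x ∈ A with R p x, w x := by
  simp_rw [Finset.sum_filter]
  rw [Finset.sum_comm]
  refine Finset.sum_le_sum fun x hx => ?_
  obtain ⟨p, hp, hpx⟩ := hR x hx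
  have := Finset.single_le_sum (f := fun p => if R p x then w x else 0)
    (fun p _ => by split_ifs <;> simp [hw]) hp
  simpa [hpx] using this

variable [DecidableEq Y] [DecidableEq Z]

/-- Removing a fibre of `f` from a set maximising weight minus cost does not increase this value. -/
lemma le_sum_fiber_of_max (S : Finset X) (w : X → ℝ) (f : X → Y) (g : X → Z) (α : Y → ℝ)
    (β : Z → ℝ) (hβ : ∀ z, 0 ≤ β z)
    (hmax : ∀ S' ⊆ S, ∑ x ∈ S', w x - ∑ y ∈ S'.image f, α y - ∑ z ∈ S'.image g, β z ≤
      ∑ x ∈ S, w x - ∑ y ∈ S.image f, α y - ∑ z ∈ S.image g, β z)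
    {x : X} (hx : x ∈ S) : α (f x) ≤ ∑ x' ∈ S with f x' = f x, w x' := by
  have h1 := hmax (S.filter fun x' => ¬ f x' = f x) (Finset.filter_subset _ _)
  have h2 := Finset.sum_filter_add_sum_filter_not S (fun x' => f x' = f x) w
  have h3 : (S.filter fun x' => ¬ f x' = f x).image f = (S.image f).erase (f x) := by
    ext y
    simp only [Finset.mem_image, Finset.mem_filter, Finset.mem_erase]
    constructor
    · rintro ⟨z, ⟨hz, hne⟩, rfl⟩
      exact ⟨hne, z, hz, rfl⟩
    · rintro ⟨hne, z, hz, rfl⟩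
      exact ⟨z, ⟨hz, hne⟩, rfl⟩
  have h4 := Finset.add_sum_erase (S.image f) α (Finset.mem_image_of_mem f hx)
  have h5 : ∑ z ∈ (S.filter fun x' => ¬ f x' = f x).image g, β z ≤ ∑ z ∈ S.image g, β z :=
    Finset.sum_le_sum_of_subset_of_nonneg
      (Finset.image_subset_image (Finset.filter_subset _ _)) fun z _ _ => hβ z
  rw [h3] at h1
  linarith

/-- Cleaning: if every nonempty fibre of `f` and of `g` costs `α` and `β`, then after paying the
total cost there is a subset each of whose nonempty fibres is at least as heavy as its cost. A
subset maximising weight minus cost will do. -/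
lemma exists_clean_subset (H : Finset X) (w : X → ℝ) (f : X → Y) (g : X → Z) (α : Y → ℝ)
    (β : Z → ℝ) (hα : ∀ y, 0 ≤ α y) (hβ : ∀ z, 0 ≤ β z) :
    ∃ S ⊆ H, ∑ x ∈ H, w x - ∑ y ∈ H.image f, α y - ∑ z ∈ H.image g, β z ≤ ∑ x ∈ S, w x ∧
      (∀ x ∈ S, α (f x) ≤ ∑ x' ∈ S with f x' = f x, w x') ∧
      ∀ x ∈ S, β (g x) ≤ ∑ x' ∈ S with g x' = g x, w x' := by
  obtain ⟨S, hS, hmax⟩ := Finset.exists_max_image H.powerset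
    (fun S => ∑ x ∈ S, w x - ∑ y ∈ S.image f, α y - ∑ z ∈ S.image g, β z)
    ⟨H, Finset.mem_powerset_self H⟩
  have hSH := Finset.mem_powerset.1 hS
  refine ⟨S, hSH, ?_, fun x hx => ?_, fun x hx => ?_⟩
  · have h1 := hmax H (Finset.mem_powerset_self H)
    have h2 : 0 ≤ ∑ y ∈ S.image f, α y := Finset.sum_nonneg fun y _ => hα y
    have h3 : 0 ≤ ∑ z ∈ S.image g, β z := Finset.sum_nonneg fun z _ => hβ z
    linarith
  · exact le_sum_fiber_of_max S w f g α β hβ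
      (fun S' hS' => hmax S' (Finset.mem_powerset.2 (hS'.trans hSH))) hx
  · refine le_sum_fiber_of_max S w g f β α hα (fun S' hS' => ?_) hx
    have := hmax S' (Finset.mem_powerset.2 (hS'.trans hSH))
    linarith

end Cleaning

variable {V : Type*} [Fintype V] {G : SimpleGraph V} {δ T : ℝ}

/-- A sequence of vertices without repetition in which consecutive vertices are adjacent. -/
def IsPathSeq (G : SimpleGraph V) {ℓ : ℕ} (x : Fin (ℓ + 1) → V) : Prop :=
  Function.Injective x ∧ ∀ i : Fin ℓ, G.Adj (x i.castSucc) (x i.succ)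

/-- A robust family of paths of length `ℓ + 1`: a path of the family, deprived of its last vertex,
has at least `D` extensions in the family, and the paths of the family joining the ends of one of
its members cannot be blocked by `s` vertices. -/
structure IsRobust (G : SimpleGraph V) (s : ℕ) (D : ℝ) {ℓ : ℕ}
    (S : Finset (Fin (ℓ + 2) → V)) : Prop where
  isPathSeq : ∀ x ∈ S, IsPathSeq G x
  extend : ∀ x ∈ S, D ≤ #{x' ∈ S | (Fin.init x' : Fin (ℓ + 1) → V) = Fin.init x}
  avoid : ∀ x ∈ S, ∀ F : Finset V, #F ≤ s → x 0 ∉ F → x (Fin.last (ℓ + 1)) ∉ F →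
    ∃ x' ∈ S, x' 0 = x 0 ∧ x' (Fin.last (ℓ + 1)) = x (Fin.last (ℓ + 1)) ∧ ∀ i, x' i ∉ F

/-- Each pair of heavily linked ends takes a share of the total heavy mass above the threshold. -/
lemma card_heavy_ends_le (ℓ : ℕ) :
    (#(Finset.image (fun x : Fin (ℓ + 2) → V => (x 0, x (Fin.last (ℓ + 1))))
      {x | IsHeavy G δ T x ∧ walkWeight G x ≠ 0}) : ℝ) * threshold δ T (ℓ + 1) ≤
      heavyMass G δ T ℓ := by
  set H : Finset (Fin (ℓ + 2) → V) := {x | IsHeavy G δ T x ∧ walkWeight G x ≠ 0} with hH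
  have h1 : heavyMass G δ T ℓ = ∑ x ∈ H, walkWeight G x := by
    unfold heavyMass
    rw [hH, ← Finset.filter_filter, Finset.sum_filter_ne_zero]
  rw [h1, ← Finset.sum_fiberwise_of_maps_to
    (g := fun x : Fin (ℓ + 2) → V => (x 0, x (Fin.last (ℓ + 1))))
    (t := H.image fun x => (x 0, x (Fin.last (ℓ + 1)))) fun x hx => Finset.mem_image_of_mem _ hx,
    ← nsmul_eq_mul]
  refine Finset.card_nsmul_le_sum _ _ _ fun p hp => ?_
  obtain ⟨x, hx, rfl⟩ := Finset.mem_image.1 hp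
  have hx := (Finset.mem_filter.1 hx).2
  refine hx.1.2.le.trans ?_
  unfold linkMass
  rw [← Finset.sum_filter_ne_zero]
  refine Finset.sum_le_sum_of_subset_of_nonneg (fun y hy => ?_) fun _ _ _ => walkWeight_nonneg _ _
  simp only [Finset.mem_filter, Finset.mem_univ, true_and] at hy
  obtain ⟨⟨hy1, hy2, hy3⟩, hy4⟩ := hy
  simp only [hH, Finset.mem_filter, Finset.mem_univ, true_and, Prod.mk.injEq]
  refine ⟨⟨⟨hy1, ?_⟩, hy4⟩, hy2, hy3⟩
  rw [hy2, hy3]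
  exact hx.1.2

/-- A set of heavily linking walks whose mass is at least `threshold / T` cannot be blocked by a
bounded number of interior vertices. -/
lemma exists_avoiding (hδ : 0 < δ) (hT : 0 < T) {ℓ s : ℕ} (hTs : s * (ℓ + 2) < T)
    {S : Finset (Fin (ℓ + 2) → V)} (hS : ∀ x ∈ S, Extends (IsLight G δ T ℓ) x)
    {u v : V} {F : Finset V} (hF : #F ≤ s) (hu : u ∉ F) (hv : v ∉ F)
    (hmass : threshold δ T (ℓ + 1) / T ≤
      ∑ x ∈ S with x 0 = u ∧ x (Fin.last (ℓ + 1)) = v, walkWeight G x) :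
    ∃ x ∈ S, x 0 = u ∧ x (Fin.last (ℓ + 1)) = v ∧ ∀ i, x i ∉ F := by
  by_contra! hcon
  have hthr := threshold_pos hδ hT (ℓ + 1)
  have h1 : ∑ x ∈ S with x 0 = u ∧ x (Fin.last (ℓ + 1)) = v, walkWeight G x ≤
      ∑ p ∈ F ×ˢ (Finset.univ : Finset (Fin (ℓ + 2))), threshold δ T (ℓ + 1) / T ^ 2 := by
    refine (sum_le_sum_sum_of_cover _ (F ×ˢ Finset.univ) (fun p x => x p.2 = p.1) _
      (walkWeight_nonneg G) ?_).trans (Finset.sum_le_sum fun p hp => ?_)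
    · intro x hx
      obtain ⟨hxS, hxu, hxv⟩ := Finset.mem_filter.1 hx
      obtain ⟨i, hi⟩ := hcon x hxS hxu hxv
      exact ⟨(x i, i), Finset.mem_product.2 ⟨hi, Finset.mem_univ _⟩, rfl⟩
    · have hpF := (Finset.mem_product.1 hp).1
      by_cases hp0 : p.2 ≠ 0 ∧ p.2 ≠ Fin.last _
      · refine le_trans ?_ (sum_through_le (G := G) hδ hT u v p.1 p.2 hp0.1 hp0.2)
        refine Finset.sum_le_sum_of_subset_of_nonneg (fun x hx => ?_)
          fun _ _ _ => walkWeight_nonneg _ _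
        simp only [Finset.mem_filter, Finset.mem_univ, true_and] at hx ⊢
        exact ⟨⟨hS x hx.1.1, hx.1.2⟩, hx.2⟩
      · rw [Finset.sum_eq_zero]
        · positivity
        · intro x hx
          exfalso
          obtain ⟨hx, hxp⟩ := Finset.mem_filter.1 hx
          obtain ⟨-, hxu, hxv⟩ := Finset.mem_filter.1 hx
          refine hp0 ⟨fun h => hu ?_, fun h => hv ?_⟩
          · rw [← hxu, ← h, hxp]; exact hpF
          · rw [← hxv, ← h, hxp]; exact hpF
  rw [Finset.sum_const, Finset.card_product, Finset.card_univ, Fintype.card_fin, nsmul_eq_mul] at h1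
  have h2 : ((#F * (ℓ + 2) : ℕ) : ℝ) ≤ s * (ℓ + 2) := by
    push_cast
    gcongr
  have h3 : ((#F * (ℓ + 2) : ℕ) : ℝ) * (threshold δ T (ℓ + 1) / T ^ 2) <
      T * (threshold δ T (ℓ + 1) / T ^ 2) :=
    mul_lt_mul_of_pos_right (h2.trans_lt hTs) (by positivity)
  have h4 : T * (threshold δ T (ℓ + 1) / T ^ 2) = threshold δ T (ℓ + 1) / T := by
    field_simp
  linarith

/-- A positive proportion of heavy walks yields a large robust family of paths. -/
lemma exists_isRobust {ε : ℝ} {ℓ s : ℕ} (hδ : 0 < δ) (hT : 4 ≤ T) (hε : 0 < ε)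
    (hTs : s * (ℓ + 2) < T)
    (hH : ε * ∑ v, vdeg G v ≤ heavyMass G δ T ℓ) :
    ∃ S : Finset (Fin (ℓ + 2) → V), IsRobust G s (ε / 4 * δ) S ∧
      ε / 2 * (∑ v, vdeg G v) * δ ^ ℓ ≤ #S := by
  set W := ∑ v, vdeg G v with hWdef
  have hT0 : 0 < T := by linarith
  have hthr := threshold_pos hδ hT0 (ℓ + 1)
  set H : Finset (Fin (ℓ + 2) → V) := {x | IsHeavy G δ T x ∧ walkWeight G x ≠ 0} with hHdef
  have hHmass : heavyMass G δ T ℓ = ∑ x ∈ H, walkWeight G x := by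
    unfold heavyMass
    rw [hHdef, ← Finset.filter_filter, Finset.sum_filter_ne_zero]
  obtain ⟨S, hSH, hSmass, hSinit, hSends⟩ := exists_clean_subset H (walkWeight G)
    (fun x => (Fin.init x : Fin (ℓ + 1) → V)) (fun x => (x 0, x (Fin.last (ℓ + 1))))
    (fun y => ε / 4 * walkWeight G y) (fun _ => threshold δ T (ℓ + 1) / T)
    (fun y => mul_nonneg (by positivity) (walkWeight_nonneg G y)) (fun _ => by positivity)
  have hmem : ∀ x ∈ S, IsHeavy G δ T x ∧ walkWeight G x ≠ 0 :=
    fun x hx => (Finset.mem_filter.1 (hSH hx)).2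
  have hcost1 : ∑ y ∈ H.image (fun x => (Fin.init x : Fin (ℓ + 1) → V)), ε / 4 * walkWeight G y ≤
      ε / 4 * W := by
    rw [← Finset.mul_sum, hWdef, ← sum_walkWeight G ℓ]
    refine mul_le_mul_of_nonneg_left ?_ (by positivity)
    exact Finset.sum_le_sum_of_subset_of_nonneg (Finset.subset_univ _)
      fun _ _ _ => walkWeight_nonneg _ _
  have hcost2 : ∑ z ∈ H.image (fun x => (x 0, x (Fin.last (ℓ + 1)))),
      threshold δ T (ℓ + 1) / T ≤ heavyMass G δ T ℓ / 4 := by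
    rw [Finset.sum_const, nsmul_eq_mul, ← mul_div_assoc]
    have h1 := card_heavy_ends_le (G := G) (δ := δ) (T := T) ℓ
    have h2 : 0 ≤ heavyMass G δ T ℓ := Finset.sum_nonneg fun _ _ => walkWeight_nonneg _ _
    exact div_le_div₀ h2 h1 (by norm_num) hT
  refine ⟨S, ⟨fun x hx => ⟨(hmem x hx).1.1.injective, adj_of_walkWeight_ne_zero (hmem x hx).2⟩,
    fun x hx => ?_, fun x hx F hF hu hv => ?_⟩, ?_⟩
  · have h1 := hSinit x hx
    have hxl : IsLight G δ T ℓ (Fin.init x) := (hmem x hx).1.1.1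
    have hpos : 0 < walkWeight G (Fin.init x : Fin (ℓ + 1) → V) := by
      refine lt_of_le_of_ne (walkWeight_nonneg _ _) fun h => (hmem x hx).2 ?_
      rw [walkWeight_init, ← h, zero_mul]
    -- Every extension takes at most the fraction `1 / δ` of the mass of `init x`.
    have h2 : ∀ x' ∈ S.filter fun x' => (Fin.init x' : Fin (ℓ + 1) → V) = Fin.init x,
        walkWeight G x' ≤ walkWeight G (Fin.init x : Fin (ℓ + 1) → V) * δ⁻¹ := by
      intro x' hx'
      obtain ⟨hx'S, hx'⟩ := Finset.mem_filter.1 hx'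
      rw [walkWeight_init, hx']
      refine mul_le_mul_of_nonneg_left ((step_le_inv _ _ _).trans ?_) hpos.le
      exact inv_anti₀ hδ ((hmem x' hx'S).1.1.le_vdeg _)
    have h3 := h1.trans (Finset.sum_le_card_nsmul _ _ _ h2)
    rw [nsmul_eq_mul, mul_comm (walkWeight G _) δ⁻¹, ← mul_assoc] at h3
    have h4 := le_of_mul_le_mul_right h3 hpos
    rwa [← div_eq_mul_inv, le_div_iff₀ hδ] at h4
  · refine exists_avoiding hδ hT0 hTs (fun y hy => (hmem y hy).1.1) hF hu hv ?_
    have := hSends x hx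
    simpa only [Prod.mk.injEq] using this
  · have h1 : ∑ x ∈ S, walkWeight G x ≤ #S * (δ⁻¹) ^ ℓ := by
      rw [← nsmul_eq_mul]
      exact Finset.sum_le_card_nsmul _ _ _ fun x hx => walkWeight_le_of_isLight hδ (hmem x hx).1.1.1
    have h2 : ε / 2 * W ≤ #S * (δ⁻¹) ^ ℓ := by
      rw [← hHmass] at hSmass
      linarith
    rwa [inv_pow, ← div_eq_mul_inv, le_div_iff₀ (by positivity)] at h2

end

/-! ### Prolonging the paths of a robust family -/

section

variable {V : Type*} {G : SimpleGraph V}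

/-- A family of at least `M₁` paths of length `k` from `u` to `v` with `R u v`, such that for every
pair `u`, `v` with `R u v` at least `M₂` paths of the family join `u` to `v` and avoid a given set
of at most `s` vertices. -/
structure IsLegFamily (G : SimpleGraph V) (R : V → V → Prop) (s : ℕ) (M₁ M₂ : ℝ) {k : ℕ}
    (L : Finset (Fin (k + 1) → V)) : Prop where
  isPathSeq : ∀ x ∈ L, IsPathSeq G x
  rel : ∀ x ∈ L, R (x 0) (x (Fin.last k))
  card : M₁ ≤ #L
  robust : ∀ u v, R u v → ∀ F : Finset V, #F ≤ s → u ∉ F → v ∉ F →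
    M₂ ≤ #{x ∈ L | x 0 = u ∧ x (Fin.last k) = v ∧ ∀ i, x i ∉ F}

lemma isPathSeq_snoc {k : ℕ} {x : Fin (k + 1) → V} {v : V} (hx : IsPathSeq G x)
    (hadj : G.Adj (x (Fin.last k)) v) (hv : ∀ i, x i ≠ v) :
    IsPathSeq G (Fin.snoc x v : Fin (k + 2) → V) := by
  refine ⟨?_, fun i => ?_⟩
  · intro i j hij
    induction i using Fin.lastCases with
    | last =>
      induction j using Fin.lastCases with
      | last => rfl
      | cast j => exact absurd (by simpa using hij.symm) (hv j)
    | cast i =>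
      induction j using Fin.lastCases with
      | last => exact absurd (by simpa using hij) (hv i)
      | cast j => exact congrArg _ (hx.1 (by simpa using hij))
  · induction i using Fin.lastCases with
    | last => simpa using hadj
    | cast i =>
      rw [Fin.succ_castSucc, Fin.snoc_castSucc, Fin.snoc_castSucc]
      exact hx.2 i

/-- The last edges `y v` of the paths in `S` with initial vertex `u`. -/
def LastEdge {ℓ : ℕ} (S : Finset (Fin (ℓ + 2) → V)) (u y v : V) : Prop :=
  ∃ x ∈ S, x 0 = u ∧ x (Fin.last ℓ).castSucc = y ∧ x (Fin.last (ℓ + 1)) = v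

variable {ℓ N : ℕ} {D : ℝ} {S : Finset (Fin (ℓ + 2) → V)}

lemma IsRobust.adj (hS : IsRobust G N D S) {u y v : V} (h : LastEdge S u y v) : G.Adj y v := by
  obtain ⟨x, hx, rfl, rfl, rfl⟩ := h
  exact (hS.isPathSeq x hx).2 (Fin.last ℓ)

lemma IsRobust.ne_top (hS : IsRobust G N D S) {u y v : V} (h : LastEdge S u y v) : u ≠ v := by
  obtain ⟨x, hx, rfl, rfl, rfl⟩ := h
  exact fun h => absurd ((hS.isPathSeq x hx).1 h) (Fin.last_pos.ne)

lemma IsRobust.ne_low (hS : IsRobust G N D S) (hℓ : 1 ≤ ℓ) {u y v : V} (h : LastEdge S u y v) :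
    u ≠ y := by
  obtain ⟨x, hx, rfl, rfl, rfl⟩ := h
  intro h
  have := congrArg Fin.val ((hS.isPathSeq x hx).1 h)
  simp at this
  omega

variable [Fintype V]

/-- Prolonging the paths of a family by one edge `v v'` with `E u v v'`, where `u` is the initial
vertex. Choices of `v'` for given `v` increase the size of the family, choices of `v` for given
`v'` increase the number of paths between given ends. -/
lemma IsLegFamily.exists_extension {R R' : V → V → Prop} {E : V → V → V → Prop} {s k : ℕ}
    {M₁ M₂ p q : ℝ} {L : Finset (Fin (k + 1) → V)} (hL : IsLegFamily G R (s + 1) M₁ M₂ L)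
    (hM₂ : 0 ≤ M₂) (hp0 : 0 ≤ p)
    (hE : ∀ u v v', E u v v' → R u v ∧ R' u v' ∧ G.Adj v v' ∧ u ≠ v')
    (hp : ∀ u v, R u v → ∀ F : Finset V, #F ≤ N → u ∉ F → v ∉ F → p ≤ #{v' | E u v v' ∧ v' ∉ F})
    (hq : ∀ u v', R' u v' → ∀ F : Finset V, #F ≤ N → u ∉ F → v' ∉ F →
      q ≤ #{v | E u v v' ∧ v ∉ F})
    (hs : s ≤ N) (hk : k + 1 ≤ N) :
    ∃ L' : Finset (Fin (k + 2) → V), IsLegFamily G R' s (M₁ * p) (M₂ * q) L' := by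
  set L' : Finset (Fin (k + 2) → V) :=
    {x | (Fin.init x : Fin (k + 1) → V) ∈ L ∧ IsPathSeq G x ∧
      E (x 0) (x (Fin.last k).castSucc) (x (Fin.last (k + 1)))} with hL'
  have hsnoc0 : ∀ (y : Fin (k + 1) → V) v, (Fin.snoc y v : Fin (k + 2) → V) 0 = y 0 :=
    fun y v => Fin.snoc_castSucc (i := 0) ..
  refine ⟨L', ⟨fun x hx => (Finset.mem_filter.1 hx).2.2.1,
    fun x hx => (hE _ _ _ (Finset.mem_filter.1 hx).2.2.2).2.1, ?_, ?_⟩⟩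
  -- The size of the family: count its members by the path deprived of its last vertex.
  · have h1 : #L' = ∑ y ∈ L, #{x ∈ L' | (Fin.init x : Fin (k + 1) → V) = y} :=
      Finset.card_eq_sum_card_fiberwise fun x hx => (Finset.mem_filter.1 hx).2.1
    have h2 : ∀ y ∈ L, p ≤ #{x ∈ L' | (Fin.init x : Fin (k + 1) → V) = y} := by
      intro y hy
      have h3 := hp (y 0) (y (Fin.last k)) (hL.rel y hy)
        (Finset.univ.image y \ {y 0, y (Fin.last k)}) ?_ (by simp) (by simp)
      · refine h3.trans (Nat.cast_le.2 ?_)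
        refine Finset.card_le_card_of_injOn (fun v' => Fin.snoc y v') ?_ ?_
        · intro v' hv'
          simp only [Finset.coe_filter, Set.mem_ofPred_eq, Finset.mem_univ, true_and] at hv'
          obtain ⟨hEv, hvF⟩ := hv'
          obtain ⟨-, hR', hadj, hne'⟩ := hE _ _ _ hEv
          have hnot : ∀ i, y i ≠ v' := by
            intro i hi
            apply hvF
            simp only [Finset.mem_sdiff, Finset.mem_image, Finset.mem_univ, true_and,
              Finset.mem_insert, Finset.mem_singleton, not_or]
            exact ⟨⟨i, hi⟩, hne'.symm, hadj.ne'⟩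
          simp only [Finset.coe_filter, Set.mem_ofPred_eq, hL', Finset.mem_filter, Finset.mem_univ,
            true_and, Fin.init_snoc, hy, and_true, hsnoc0, Fin.snoc_castSucc, Fin.snoc_last]
          exact ⟨isPathSeq_snoc (hL.isPathSeq y hy) hadj hnot, hEv⟩
        · intro v _ v' _ h
          simpa using congrFun h (Fin.last (k + 1))
      · refine (Finset.card_le_card Finset.sdiff_subset).trans ?_
        refine Finset.card_image_le.trans ?_
        simpa using hk
    rw [h1]
    push_cast
    calc M₁ * p ≤ #L * p := mul_le_mul_of_nonneg_right hL.card hp0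
      _ = #L • p := (nsmul_eq_mul _ _).symm
      _ ≤ _ := Finset.card_nsmul_le_sum _ _ _ h2
  -- Paths with given ends: count them by their last vertex but one.
  · intro u w huw F hF hu hw
    have h1 := hq u w huw F (hF.trans hs) hu hw
    set A : Finset V := {v | E u v w ∧ v ∉ F} with hA
    set B : Finset (Fin (k + 2) → V) :=
      {x ∈ L' | x 0 = u ∧ x (Fin.last (k + 1)) = w ∧ ∀ i, x i ∉ F} with hB
    have h2 : ∀ v ∈ A, M₂ ≤ #{x ∈ B | x (Fin.last k).castSucc = v} := by
      intro v hv
      obtain ⟨hEv, hvF⟩ := (Finset.mem_filter.1 hv).2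
      obtain ⟨hRv, -, hadj, hne'⟩ := hE _ _ _ hEv
      have h3 := hL.robust u v hRv (insert w F) ((Finset.card_insert_le _ _).trans (by omega))
        (by simp [hu, hne']) (by simp [hvF, hadj.ne])
      refine h3.trans (Nat.cast_le.2 ?_)
      refine Finset.card_le_card_of_injOn (fun y => Fin.snoc y w) ?_ ?_
      · intro y hy
        simp only [Finset.coe_filter, Set.mem_ofPred_eq, Finset.mem_insert, not_or] at hy
        obtain ⟨hyL, hy0, hyl, hyF⟩ := hy
        simp only [Finset.coe_filter, Set.mem_ofPred_eq, hB, hL', Finset.mem_filter,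
          Finset.mem_univ, true_and, Fin.init_snoc, hyL, hsnoc0, Fin.snoc_castSucc,
          Fin.snoc_last, hy0, hyl, hEv, and_true]
        refine ⟨isPathSeq_snoc (hL.isPathSeq y hyL) (hyl ▸ hadj) fun i => (hyF i).1, fun i => ?_⟩
        induction i using Fin.lastCases with
        | last => simpa using hw
        | cast i => simpa using (hyF i).2
      · intro y _ y' _ h
        have := congrArg (fun x : Fin (k + 2) → V => (Fin.init x : Fin (k + 1) → V)) h
        simpa using this
    have h3 : ∑ v ∈ A, #{x ∈ B | x (Fin.last k).castSucc = v} ≤ #B := by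
      rw [← Finset.card_biUnion]
      · exact Finset.card_le_card (Finset.biUnion_subset.2 fun v _ => Finset.filter_subset _ _)
      · intro v _ v' _ hvv
        refine Finset.disjoint_left.2 fun x hx hx' => hvv ?_
        rw [← (Finset.mem_filter.1 hx).2, (Finset.mem_filter.1 hx').2]
    calc M₂ * q ≤ M₂ * #A := mul_le_mul_of_nonneg_left h1 hM₂
      _ = #A • M₂ := by rw [nsmul_eq_mul, mul_comm]
      _ ≤ ∑ v ∈ A, (#{x ∈ B | x (Fin.last k).castSucc = v} : ℝ) :=
          Finset.card_nsmul_le_sum _ _ _ h2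
      _ ≤ #B := by exact_mod_cast h3

lemma IsRobust.card_up (hS : IsRobust G N D S) {u y : V} (h : ∃ v, LastEdge S u y v)
    {F : Finset V} (hF : #F ≤ N) : D - N ≤ #{v | LastEdge S u y v ∧ v ∉ F} := by
  obtain ⟨v, x, hx, rfl, rfl, rfl⟩ := h
  have h1 := hS.extend x hx
  have h2 : #{x' ∈ S | (Fin.init x' : Fin (ℓ + 1) → V) = Fin.init x} ≤
      #{v | LastEdge S (x 0) (x (Fin.last ℓ).castSucc) v} := by
    refine Finset.card_le_card_of_injOn (fun x' => x' (Fin.last (ℓ + 1))) ?_ ?_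
    · intro x' hx'
      obtain ⟨hx'S, hx'⟩ := Finset.mem_filter.1 hx'
      simp only [Finset.coe_filter, Finset.mem_univ, true_and, Set.mem_ofPred_eq]
      exact ⟨x', hx'S, congrFun hx' 0, congrFun hx' (Fin.last ℓ), rfl⟩
    · intro x₁ h₁ x₂ h₂ h
      have h₁ := (Finset.mem_filter.1 h₁).2
      have h₂ := (Finset.mem_filter.1 h₂).2
      rw [← Fin.snoc_init_self x₁, ← Fin.snoc_init_self x₂, h₁, h₂]
      exact congrArg _ h
  have h3 : #{v | LastEdge S (x 0) (x (Fin.last ℓ).castSucc) v} ≤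
      #{v | LastEdge S (x 0) (x (Fin.last ℓ).castSucc) v ∧ v ∉ F} + #F := by
    refine (Finset.card_le_card (t := _ ∪ F) fun v hv => ?_).trans (Finset.card_union_le _ _)
    simp only [Finset.mem_union, Finset.mem_filter, Finset.mem_univ, true_and] at hv ⊢
    by_cases hvF : v ∈ F
    · exact Or.inr hvF
    · exact Or.inl ⟨hv, hvF⟩
  have h4 : (#{x' ∈ S | (Fin.init x' : Fin (ℓ + 1) → V) = Fin.init x} : ℝ) ≤
      #{v | LastEdge S (x 0) (x (Fin.last ℓ).castSucc) v ∧ v ∉ F} + N := by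
    exact_mod_cast h2.trans (h3.trans (Nat.add_le_add_left hF _))
  linarith

lemma IsRobust.card_down (hS : IsRobust G N D S) {u v : V} (h : ∃ y, LastEdge S u y v)
    {F : Finset V} (hF : #F ≤ N) (hu : u ∉ F) (hv : v ∉ F) :
    (1 : ℝ) ≤ #{y | LastEdge S u y v ∧ y ∉ F} := by
  obtain ⟨y, x, hx, rfl, rfl, rfl⟩ := h
  obtain ⟨x', hx', h0, hl, hxF⟩ := hS.avoid x hx F hF hu hv
  have : 0 < #{y | LastEdge S (x 0) y (x (Fin.last (ℓ + 1))) ∧ y ∉ F} := by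
    refine Finset.card_pos.2 ⟨x' (Fin.last ℓ).castSucc, ?_⟩
    simp only [Finset.mem_filter, Finset.mem_univ, true_and]
    exact ⟨⟨x', hx', h0, rfl, hl⟩, hxF _⟩
  exact_mod_cast this

/-- Prolonging the paths of a robust family by walking `r` steps back and forth along last edges.
Each step away from the terminal vertices of `S` increases the number of paths between given ends
by the factor `D - N`, and each step back to them increases the number of paths by this factor. -/
lemma IsRobust.exists_isLegFamily (hS : IsRobust G N D S) (hℓ : 1 ≤ ℓ) (hD : N ≤ D) (r s : ℕ)
    (hs : s + r ≤ N) (hr : ℓ + 1 + r ≤ N) :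
    ∃ (R : V → V → Prop) (M₁ M₂ : ℝ) (L : Finset (Fin (ℓ + 1 + r + 1) → V)),
      ((R = fun u v => ∃ y, LastEdge S u y v) ∨ (R = fun u y => ∃ v, LastEdge S u y v)) ∧
      0 ≤ M₁ ∧ 0 ≤ M₂ ∧ M₁ * M₂ = #S * (D - N) ^ r ∧ IsLegFamily G R s M₁ M₂ L := by
  induction r generalizing s with
  | zero =>
    refine ⟨_, #S, 1, S, Or.inl rfl, by positivity, by norm_num, by simp, hS.isPathSeq,
      fun x hx => ⟨_, x, hx, rfl, rfl, rfl⟩, le_rfl, ?_⟩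
    rintro u v ⟨y, x, hx, rfl, rfl, rfl⟩ F hF hu hv
    obtain ⟨x', hx', h0, hl, hxF⟩ := hS.avoid x hx F (by omega) hu hv
    have : 0 < #{y ∈ S | y 0 = x 0 ∧ y (Fin.last (ℓ + 1)) = x (Fin.last (ℓ + 1)) ∧
        ∀ i, y i ∉ F} :=
      Finset.card_pos.2 ⟨x', Finset.mem_filter.2 ⟨hx', h0, hl, hxF⟩⟩
    exact_mod_cast this
  | succ r ih =>
    obtain ⟨R, M₁, M₂, L, hR, hM₁, hM₂, hM, hL⟩ := ih (s + 1) (by omega) (by omega)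
    have hDN : 0 ≤ D - N := sub_nonneg.2 hD
    rcases hR with rfl | rfl
    -- A step away from the terminal vertices of `S`.
    · obtain ⟨L', hL'⟩ := hL.exists_extension (R' := fun u y => ∃ v, LastEdge S u y v)
        (E := fun u v y => LastEdge S u y v) (N := N) (p := 1) (q := D - N) hM₂ (by norm_num)
        (fun u v y h => ⟨⟨y, h⟩, ⟨v, h⟩, (hS.adj h).symm, hS.ne_low hℓ h⟩)
        (fun u v h F hF hu hv => hS.card_down h hF hu hv)
        (fun u y h F hF _ _ => hS.card_up h hF)
        (by omega) (by omega)
      exact ⟨_, M₁ * 1, M₂ * (D - N), L', Or.inr rfl, by positivity, mul_nonneg hM₂ hDN,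
        by linear_combination (D - N) * hM, hL'⟩
    -- A step back to the terminal vertices of `S`.
    · obtain ⟨L', hL'⟩ := hL.exists_extension (R' := fun u v => ∃ y, LastEdge S u y v)
        (E := fun u y v => LastEdge S u y v) (N := N) (p := D - N) (q := 1) hM₂ hDN
        (fun u y v h => ⟨⟨v, h⟩, ⟨y, h⟩, hS.adj h, hS.ne_top h⟩)
        (fun u y h F hF _ _ => hS.card_up h hF)
        (fun u v h F hF hu hv => hS.card_down h hF hu hv)
        (by omega) (by omega)
      exact ⟨_, M₁ * (D - N), M₂ * 1, L', Or.inl rfl, mul_nonneg hM₁ hDN, by positivity,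
        by linear_combination (D - N) * hM, hL'⟩

end

/-! ### Theta graphs from families of legs -/

section

section Theta

variable {V : Type*} {G : SimpleGraph V} {a b : ℕ}

lemma thetaPathVertex_zero (i : Fin a) : thetaPathVertex a b i 0 = Sum.inl 0 := by
  simp [thetaPathVertex]

lemma thetaPathVertex_self (hb : 1 ≤ b) (i : Fin a) : thetaPathVertex a b i b = Sum.inl 1 := by
  unfold thetaPathVertex
  rw [if_neg (by omega), dif_neg (by omega)]

lemma thetaPathVertex_interior (i : Fin a) {j : ℕ} (h0 : j ≠ 0) (hj : j - 1 < b - 1) :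
    thetaPathVertex a b i j = Sum.inr (i, ⟨j - 1, hj⟩) := by
  unfold thetaPathVertex
  rw [if_neg h0, dif_pos hj]

/-- The map from the theta graph given by a family of sequences with common ends `u` and `v`; the
entries of the sequences at the ends are not used. -/
def thetaMap (f : Fin a → Fin (b + 1) → V) (u v : V) : ThetaVertex a b → V
  | Sum.inl e => if e = 0 then u else v
  | Sum.inr (i, k) => f i ⟨k + 1, by omega⟩

lemma thetaMap_thetaPathVertex (hb : 1 ≤ b) {f : Fin a → Fin (b + 1) → V} {u v : V}
    (h0 : ∀ i, f i 0 = u) (hl : ∀ i, f i (Fin.last b) = v) (i : Fin a) (j : Fin (b + 1)) :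
    thetaMap f u v (thetaPathVertex a b i j) = f i j := by
  rcases eq_or_ne j 0 with rfl | hj0
  · simp [thetaPathVertex_zero, thetaMap, h0]
  rcases eq_or_ne j (Fin.last b) with rfl | hjl
  · simp [thetaPathVertex_self hb, thetaMap, hl]
  have h1 : (j : ℕ) ≠ 0 := fun h => hj0 (Fin.ext h)
  have h2 : (j : ℕ) ≠ b := fun h => hjl (Fin.ext h)
  rw [thetaPathVertex_interior i h1 (by omega)]
  simp only [thetaMap]
  congr 1
  ext
  simp
  omega

/-- Paths with common ends that are disjoint apart from the ends form a theta graph. -/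
lemma exists_copy_thetaGraph (hb : 1 ≤ b) {f : Fin a → Fin (b + 1) → V} {u v : V}
    (h0 : ∀ i, f i 0 = u) (hl : ∀ i, f i (Fin.last b) = v) (huv : u ≠ v)
    (hf : ∀ i, IsPathSeq G (f i))
    (hdisj : ∀ i j p q, i ≠ j → f i p = f j q → f i p = u ∨ f i p = v) :
    ∃ c : SimpleGraph.Copy (thetaGraph a b) G,
      ∀ (i : Fin a) (j : Fin (b + 1)), c (thetaPathVertex a b i j) = f i j := by
  have hmap := thetaMap_thetaPathVertex hb h0 hl
  have hadj : ∀ x y, (∃ (i : Fin a) (j : Fin b), x = thetaPathVertex a b i j ∧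
      y = thetaPathVertex a b i (j + 1)) → G.Adj (thetaMap f u v x) (thetaMap f u v y) := by
    rintro x y ⟨i, j, rfl, rfl⟩
    have h1 := hmap i j.castSucc
    have h2 := hmap i j.succ
    simp only [Fin.val_castSucc, Fin.val_succ] at h1 h2
    rw [h1, h2]
    exact (hf i).2 j
  have hinner : ∀ (i : Fin a) (k : Fin (b - 1)),
      f i ⟨k + 1, by omega⟩ ≠ u ∧ f i ⟨k + 1, by omega⟩ ≠ v := by
    intro i k
    constructor
    · intro h
      have := congrArg Fin.val ((hf i).1 (h.trans (h0 i).symm))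
      simp at this
    · intro h
      have := congrArg Fin.val ((hf i).1 (h.trans (hl i).symm))
      simp at this
      omega
  let φ : thetaGraph a b →g G :=
    { toFun := thetaMap f u v
      map_rel' := by
        intro x y hxy
        rcases hxy.2 with h | h
        · exact hadj x y h
        · exact (hadj y x h).symm }
  have hinj : Function.Injective φ := by
    rintro (e | ⟨i, k⟩) (e' | ⟨i', k'⟩) h
    · change (if e = 0 then u else v) = (if e' = 0 then u else v) at h
      congr 1
      fin_cases e <;> fin_cases e' <;> simp_all
    · exfalso
      change (if e = 0 then u else v) = f i' ⟨k' + 1, _⟩ at h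
      split_ifs at h
      · exact (hinner i' k').1 h.symm
      · exact (hinner i' k').2 h.symm
    · exfalso
      change f i ⟨k + 1, _⟩ = (if e' = 0 then u else v) at h
      split_ifs at h
      · exact (hinner i k).1 h
      · exact (hinner i k).2 h
    · change f i ⟨k + 1, _⟩ = f i' ⟨k' + 1, _⟩ at h
      by_cases hii : i = i'
      · subst hii
        have := congrArg Fin.val ((hf i).1 h)
        simp only [Nat.add_right_cancel_iff] at this
        rw [Fin.ext this]
      · exfalso
        rcases hdisj _ _ _ _ hii h with h | h
        · exact (hinner i k).1 h
        · exact (hinner i k).2 h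
  exact ⟨⟨φ, hinj⟩, fun i j => hmap i j⟩

/-- The vertices of a sequence other than `u` and `v`. -/
noncomputable def innerVertices {k : ℕ} (x : Fin (k + 1) → V) (u v : V) : Finset V :=
  Finset.univ.image x \ {u, v}

lemma card_innerVertices_le {k : ℕ} (x : Fin (k + 1) → V) (u v : V) :
    #(innerVertices x u v) ≤ k + 1 := by
  refine (Finset.card_le_card Finset.sdiff_subset).trans (Finset.card_image_le.trans ?_)
  simp

variable {R : V → V → Prop} {s : ℕ} {M₁ M₂ : ℝ} {L : Finset (Fin (b + 1) → V)}

/-- Two internally disjoint paths of the family can be completed to any bounded number of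
internally disjoint paths. -/
lemma IsLegFamily.exists_legs (hL : IsLegFamily G R s M₁ M₂ L) (hM₂ : 0 < M₂)
    (hs : a * (b + 1) ≤ s) {x₁ x₂ : Fin (b + 1) → V} {u v : V} (huv : R u v)
    (h₁ : x₁ ∈ L ∧ x₁ 0 = u ∧ x₁ (Fin.last b) = v)
    (h₂ : x₂ ∈ L ∧ x₂ 0 = u ∧ x₂ (Fin.last b) = v)
    (h₁₂ : ∀ p, x₂ p ∉ innerVertices x₁ u v) (k : ℕ) (hk : k + 2 ≤ a) :
    ∃ g : ℕ → Fin (b + 1) → V, g 0 = x₁ ∧ g 1 = x₂ ∧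
      (∀ i < k + 2, g i ∈ L ∧ g i 0 = u ∧ g i (Fin.last b) = v) ∧
      ∀ i j, i < j → j < k + 2 → ∀ p, g j p ∉ innerVertices (g i) u v := by
  induction k with
  | zero =>
    refine ⟨fun i => if i = 0 then x₁ else x₂, by simp, by simp, fun i hi => ?_,
      fun i j hij hj p => ?_⟩
    · rcases i with _ | i
      · simpa using h₁
      · simpa using h₂
    · obtain rfl : i = 0 := by omega
      obtain rfl : j = 1 := by omega
      simpa using h₁₂ p
  | succ k ih =>
    obtain ⟨g, hg0, hg1, hgL, hgd⟩ := ih (by omega)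
    set F : Finset V := (Finset.range (k + 2)).biUnion fun i => innerVertices (g i) u v with hF
    have hFcard : #F ≤ s := by
      refine (Finset.card_biUnion_le_card_mul _ _ (b + 1)
        fun i _ => card_innerVertices_le _ _ _).trans (le_trans ?_ hs)
      rw [Finset.card_range]
      exact Nat.mul_le_mul_right _ (by omega)
    have h3 := hL.robust u v huv F hFcard (by simp [hF, innerVertices])
      (by simp [hF, innerVertices])
    obtain ⟨x, hx⟩ : ({x ∈ L | x 0 = u ∧ x (Fin.last b) = v ∧ ∀ i, x i ∉ F} :
        Finset (Fin (b + 1) → V)).Nonempty := by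
      rw [← Finset.card_pos]
      exact_mod_cast hM₂.trans_le h3
    obtain ⟨hxL, hxu, hxv, hxF⟩ := Finset.mem_filter.1 hx
    refine ⟨Function.update g (k + 2) x, ?_, ?_, fun i hi => ?_, fun i j hij hj p => ?_⟩
    · rw [Function.update_of_ne (by omega), hg0]
    · rw [Function.update_of_ne (by omega), hg1]
    · rcases eq_or_ne i (k + 2) with rfl | hne
      · simpa using ⟨hxL, hxu, hxv⟩
      · rw [Function.update_of_ne hne]
        exact hgL i (by omega)
    · rw [Function.update_of_ne (a := i) (by omega)]
      rcases eq_or_ne j (k + 2) with rfl | hne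
      · rw [Function.update_self]
        intro h
        exact hxF p (Finset.mem_biUnion.2 ⟨i, Finset.mem_range.2 hij, h⟩)
      · rw [Function.update_of_ne hne]
        exact hgd i j hij (by omega) p

/-- Two internally disjoint paths of the family are legs of a theta graph. -/
lemma IsLegFamily.exists_copy (hL : IsLegFamily G R s M₁ M₂ L) (hM₂ : 0 < M₂) (ha : 2 ≤ a)
    (hb : 1 ≤ b) (hs : a * (b + 1) ≤ s) {x₁ x₂ : Fin (b + 1) → V} (hx₁ : x₁ ∈ L) (hx₂ : x₂ ∈ L)
    (h0 : x₂ 0 = x₁ 0) (hl : x₂ (Fin.last b) = x₁ (Fin.last b))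
    (hd : ∀ p, x₂ p ∉ innerVertices x₁ (x₁ 0) (x₁ (Fin.last b))) :
    ∃ c : SimpleGraph.Copy (thetaGraph a b) G, ∀ j : Fin (b + 1),
      c (thetaPathVertex a b ⟨0, by omega⟩ j) = x₁ j ∧
      c (thetaPathVertex a b ⟨1, by omega⟩ j) = x₂ j := by
  obtain ⟨g, hg0, hg1, hgL, hgd⟩ := hL.exists_legs hM₂ hs (hL.rel x₁ hx₁) ⟨hx₁, rfl, rfl⟩
    ⟨hx₂, h0, hl⟩ hd (a - 2) (by omega)
  have hends : x₁ 0 ≠ x₁ (Fin.last b) := by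
    intro h
    have := congrArg Fin.val ((hL.isPathSeq x₁ hx₁).1 h)
    simp at this
    omega
  have hcommon : ∀ i j : ℕ, i < j → j < a → ∀ p q, g j p = g i q →
      g j p = x₁ 0 ∨ g j p = x₁ (Fin.last b) := by
    intro i j hij hj p q h
    have := hgd i j hij (by omega) p
    by_contra! hc
    apply this
    simp only [innerVertices, Finset.mem_sdiff, Finset.mem_image, Finset.mem_univ, true_and,
      Finset.mem_insert, Finset.mem_singleton, not_or]
    exact ⟨⟨q, h.symm⟩, hc⟩
  obtain ⟨c, hc⟩ := exists_copy_thetaGraph (G := G) hb (f := fun i : Fin a => g i)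
    (u := x₁ 0) (v := x₁ (Fin.last b)) (fun i => (hgL i (by omega)).2.1)
    (fun i => (hgL i (by omega)).2.2) hends (fun i => hL.isPathSeq _ (hgL i (by omega)).1) (by
      intro i j p q hij h
      rcases lt_or_gt_of_ne (fun h => hij (Fin.ext h) : (i : ℕ) ≠ j) with hlt | hlt
      · rw [h]
        exact hcommon i j hlt j.2 q p h.symm
      · exact hcommon j i hlt i.2 p q h)
  refine ⟨c, fun j => ⟨?_, ?_⟩⟩
  · rw [hc, hg0]
  · rw [hc, hg1]

lemma labelledCopyCount_eq_natCard {W : Type*} [Fintype V] [Fintype W] (G : SimpleGraph V)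
    (H : SimpleGraph W) : G.labelledCopyCount H = Nat.card (SimpleGraph.Copy H G) := by
  rw [SimpleGraph.labelledCopyCount, Fintype.card_eq_nat_card]

lemma card_le_labelledCopyCount {α W : Type*} [Fintype V] [Fintype W] {H : SimpleGraph W}
    (P : Finset α) (Q : α → SimpleGraph.Copy H G → Prop) (hQ : ∀ p ∈ P, ∃ c, Q p c)
    (hinj : ∀ p p' c, Q p c → Q p' c → p = p') : #P ≤ G.labelledCopyCount H := by
  choose c hc using hQ
  have hfin : Finite (SimpleGraph.Copy H G) := inferInstance
  rw [labelledCopyCount_eq_natCard, ← Fintype.card_coe, ← Nat.card_eq_fintype_card]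
  refine Nat.card_le_card_of_injective (fun p : P => c p.1 p.2) fun p p' h => ?_
  have h : c p.1 p.2 = c p'.1 p'.2 := h
  refine Subtype.ext (hinj p.1 p'.1 _ (hc p.1 p.2) ?_)
  rw [h]
  exact hc p'.1 p'.2

/-- The first leg of a theta graph can be chosen in `M₁` ways and the second one in `M₂` ways. -/
lemma IsLegFamily.mul_le_labelledCopyCount [Fintype V] (hL : IsLegFamily G R s M₁ M₂ L)
    (hM₂ : 0 < M₂) (ha : 2 ≤ a) (hb : 1 ≤ b) (hs : a * (b + 1) ≤ s) :
    M₁ * M₂ ≤ G.labelledCopyCount (thetaGraph a b) := by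
  set P : Finset ((Fin (b + 1) → V) × (Fin (b + 1) → V)) :=
    {p ∈ L ×ˢ L | p.2 0 = p.1 0 ∧ p.2 (Fin.last b) = p.1 (Fin.last b) ∧
      ∀ i, p.2 i ∉ innerVertices p.1 (p.1 0) (p.1 (Fin.last b))} with hP
  have hPcard : M₁ * M₂ ≤ #P := by
    have h1 : #P = ∑ x ∈ L, #{p ∈ P | p.1 = x} := Finset.card_eq_sum_card_fiberwise
      fun p hp => (Finset.mem_product.1 (Finset.mem_filter.1 hp).1).1
    have h2 : ∀ x ∈ L, M₂ ≤ #{p ∈ P | p.1 = x} := by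
      intro x hx
      have hin : #(innerVertices x (x 0) (x (Fin.last b))) ≤ s := by
        refine (card_innerVertices_le _ _ _).trans (le_trans ?_ hs)
        exact Nat.le_mul_of_pos_left _ (by omega)
      refine (hL.robust _ _ (hL.rel x hx) _ hin (by simp [innerVertices])
        (by simp [innerVertices])).trans (Nat.cast_le.2 ?_)
      refine Finset.card_le_card_of_injOn (fun y => (x, y)) ?_ fun y _ y' _ h => by simpa using h
      intro y hy
      obtain ⟨hyL, hy⟩ := Finset.mem_filter.1 hy
      exact Finset.mem_filter.2
        ⟨Finset.mem_filter.2 ⟨Finset.mem_product.2 ⟨hx, hyL⟩, hy⟩, rfl⟩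
    rw [h1]
    push_cast
    calc M₁ * M₂ ≤ #L * M₂ := mul_le_mul_of_nonneg_right hL.card hM₂.le
      _ = #L • M₂ := (nsmul_eq_mul _ _).symm
      _ ≤ _ := Finset.card_nsmul_le_sum _ _ _ h2
  refine hPcard.trans (Nat.cast_le.2 ?_)
  refine card_le_labelledCopyCount P (fun p c => ∀ j : Fin (b + 1),
    c (thetaPathVertex a b ⟨0, by omega⟩ j) = p.1 j ∧
    c (thetaPathVertex a b ⟨1, by omega⟩ j) = p.2 j) ?_ ?_
  · intro p hp
    obtain ⟨hpL, h0, hl, hd⟩ := Finset.mem_filter.1 hp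
    obtain ⟨hx₁, hx₂⟩ := Finset.mem_product.1 hpL
    exact hL.exists_copy hM₂ ha hb hs hx₁ hx₂ h0 hl hd
  · intro p p' c h h'
    refine Prod.ext (funext fun j => ?_) (funext fun j => ?_)
    · rw [← (h j).1, (h' j).1]
    · rw [← (h j).2, (h' j).2]

end Theta

section Sparse

variable {V : Type*} [Fintype V] {G : SimpleGraph V}

lemma sum_vdeg_eq (G : SimpleGraph V) : ∑ v, vdeg G v = 2 * (G.edgeSet.ncard : ℝ) := by
  have h1 : ∀ v, vdeg G v = (G.degree v : ℝ) := by
    intro v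
    unfold vdeg
    rw [Finset.sum_boole, ← SimpleGraph.card_neighborFinset_eq_degree,
      SimpleGraph.neighborFinset_eq_filter]
  simp_rw [h1]
  rw [← Nat.cast_sum, G.sum_degrees_eq_twice_card_edges, ← SimpleGraph.coe_edgeFinset,
    Set.ncard_coe_finset]
  push_cast
  rfl

/-- A quadratic number of theta graphs, under a lower bound on `δ`, which is the multiple of the
average degree by `ε`. At most `N` vertices have to be avoided at any time, `T` is the parameter
of the thresholds, and `δ` has to be at least `B * n ^ (1 / b)`. -/
lemma mul_card_sq_le_labelledCopyCount [Nonempty V] {a b N : ℕ} {ε T δ B : ℝ} (ha : 2 ≤ a)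
    (hb : 1 ≤ b) (hN : a * (b + 1) + b ≤ N) (hε : 0 < ε) (hε4 : 4 ^ b * ε ≤ 1 / 2) (hT : 4 ≤ T)
    (hTN : N * (b + 1) < T) (hBT : T ^ 3 ≤ B) (hBN : 8 * N / ε ≤ B)
    (hδ : Fintype.card V * δ = ε * ∑ v, vdeg G v) (hBδ : B ≤ δ)
    (hδb : Fintype.card V * B ^ b ≤ δ ^ b) :
    (ε / 8) ^ b / 2 * (Fintype.card V : ℝ) ^ 2 ≤ G.labelledCopyCount (thetaGraph a b) := by
  set n : ℝ := (Fintype.card V : ℝ) with hn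
  set W := ∑ v, vdeg G v with hWdef
  have hn1 : 1 ≤ n := by
    rw [hn]; exact_mod_cast Fintype.card_pos
  have hN1 : (1 : ℝ) ≤ N := by
    have : 1 ≤ N := by omega
    exact_mod_cast this
  have hT0 : 0 < T := by linarith
  have hB : 0 < B := lt_of_lt_of_le (by positivity) hBT
  have hδ0 : 0 < δ := hB.trans_le hBδ
  have hW : W = n * δ / ε := by rw [hδ]; field_simp
  have hW0 : 0 < W := by rw [hW]; positivity
  have hε1 : ε ≤ 1 / 2 := by
    have : (1 : ℝ) ≤ 4 ^ b := one_le_pow₀ (by norm_num)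
    nlinarith
  have hNδ : 8 * N ≤ ε * δ := by
    have := hBN.trans hBδ
    rw [div_le_iff₀ hε] at this
    linarith
  have hinv : δ⁻¹ ≤ ε := by
    rw [inv_le_iff_one_le_mul₀ hδ0]
    linarith
  have hBpow : T ^ (3 * b) ≤ B ^ b := by
    rw [pow_mul]
    exact pow_le_pow_left₀ (by positivity) hBT b
  -- This excludes that half of the mass is carried by light walks of length `b`.
  have hthr : n ^ 2 * threshold δ T b < W / 2 := by
    have h1 : n ^ 2 * threshold δ T b = n * (n * T ^ (3 * b)) * δ / (δ ^ b * T ^ 2) := by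
      unfold threshold
      rw [div_pow, ← pow_mul]
      field_simp
    rw [h1, div_lt_iff₀ (by positivity), hW]
    have h2 : n * T ^ (3 * b) ≤ δ ^ b := (mul_le_mul_of_nonneg_left hBpow (by positivity)).trans hδb
    have h3 : n * (n * T ^ (3 * b)) * δ ≤ n * δ * δ ^ b := by
      have := mul_le_mul_of_nonneg_left h2 (show 0 ≤ n * δ by positivity)
      linarith
    have h4 : n * δ * δ ^ b * 1 < n * δ * δ ^ b * (T ^ 2 / (2 * ε)) := by
      refine mul_lt_mul_of_pos_left ?_ (by positivity)
      rw [lt_div_iff₀ (by positivity)]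
      nlinarith
    calc _ ≤ n * δ * δ ^ b * 1 := by linarith
      _ < _ := h4
      _ = _ := by field_simp
  obtain ⟨ℓ, hℓb, hheavy⟩ := exists_heavyMass (G := G) hδ0 hT0 hε4 hb hW0 hδ.le hinv hthr
  have hℓ : 1 ≤ ℓ := by
    by_contra! h
    obtain rfl : ℓ = 0 := by omega
    rw [heavyMass_zero (by linarith) hδ0] at hheavy
    have : 0 < ε * W := by positivity
    linarith
  have hTℓ : (N : ℝ) * (ℓ + 2) < T := by
    refine lt_of_le_of_lt ?_ hTN
    have : (ℓ : ℝ) + 1 ≤ b := by exact_mod_cast hℓb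
    have : (ℓ : ℝ) + 2 ≤ b + 1 := by linarith
    gcongr
  obtain ⟨S, hS, hScard⟩ := exists_isRobust (s := N) hδ0 hT hε hTℓ hheavy
  obtain ⟨r, rfl⟩ : ∃ r, b = ℓ + 1 + r := ⟨b - (ℓ + 1), by omega⟩
  have hD : ε / 8 * δ ≤ ε / 4 * δ - N := by linarith
  have hD0 : (N : ℝ) ≤ ε / 4 * δ := by linarith
  obtain ⟨R, M₁, M₂, L, -, hM₁, hM₂, hM, hL⟩ :=
    hS.exists_isLegFamily hℓ hD0 r (a * (ℓ + 1 + r + 1)) (by omega) (by omega)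
  -- The lower bound for `#S` contributes `n * δ ^ (ℓ + 1)`, and the `r` further steps `δ ^ r`.
  have hfinal : (ε / 8) ^ (ℓ + 1 + r) / 2 * n ^ 2 ≤ M₁ * M₂ := by
    rw [hM]
    have h1 : (ε / 8 * δ) ^ r ≤ (ε / 4 * δ - N) ^ r := pow_le_pow_left₀ (by positivity) hD r
    have h2 : ε / 2 * W * δ ^ ℓ * (ε / 8 * δ) ^ r ≤ #S * (ε / 4 * δ - N) ^ r :=
      mul_le_mul hScard h1 (by positivity) (Nat.cast_nonneg _)
    refine le_trans ?_ h2
    have h3 : ε / 2 * W * δ ^ ℓ * (ε / 8 * δ) ^ r =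
        (ε / 8) ^ r / 2 * (n * δ ^ (ℓ + 1 + r)) := by
      rw [hW, mul_pow, pow_add, pow_add]
      field_simp
    have h4 : (ε / 8) ^ (ℓ + 1 + r) ≤ (ε / 8) ^ r :=
      pow_le_pow_of_le_one (by positivity) (by linarith) (by omega)
    have hB1 : 1 ≤ B := le_trans (one_le_pow₀ (by linarith)) hBT
    have h5 : n ≤ δ ^ (ℓ + 1 + r) :=
      (le_mul_of_one_le_right (by positivity) (one_le_pow₀ hB1)).trans hδb
    rw [h3, sq]
    gcongr
  have hM₂0 : 0 < M₂ := by
    refine lt_of_le_of_ne hM₂ fun h => ?_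
    rw [← h, mul_zero] at hfinal
    have : 0 < (ε / 8) ^ (ℓ + 1 + r) / 2 * n ^ 2 := by positivity
    linarith
  exact hfinal.trans (hL.mul_le_labelledCopyCount hM₂0 ha (by omega) le_rfl)

end Sparse

/-- Graphs with `C n ^ (1 + 1 / b)` edges contain a quadratic number of labelled theta graphs. -/
theorem exists_quadratic_labelledCopyCount {a b : ℕ} (ha : 2 ≤ a) (hb : 1 ≤ b) :
    ∃ C : ℝ, 1 ≤ C ∧ ∃ c : ℝ, 0 < c ∧
      ∀ (V : Type*) [Fintype V] [Nonempty V] (G : SimpleGraph V),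
        C * (Fintype.card V : ℝ) ^ (1 + 1 / (b : ℝ)) ≤ (G.edgeSet.ncard : ℝ) →
        c * (Fintype.card V : ℝ) ^ 2 ≤ (G.labelledCopyCount (thetaGraph a b) : ℝ) := by
  -- `N` bounds the number of vertices of a theta graph and the number of steps of a leg, `ε` keeps
  -- the bad mass below one half over `b` doublings, and `T` and `B` dominate the error terms.
  set N : ℕ := a * (b + 1) + b with hN
  set ε : ℝ := 1 / (2 * 4 ^ b) with hε
  set T : ℝ := N * (b + 1) + 4 with hT
  set B : ℝ := T ^ 3 + 8 * N / ε with hB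
  have hε0 : 0 < ε := by positivity
  have hT4 : 4 ≤ T := by rw [hT]; linarith [show (0 : ℝ) ≤ N * (b + 1) by positivity]
  have hB1 : 1 ≤ B := by
    have h1 : (1 : ℝ) ≤ T ^ 3 := one_le_pow₀ (by linarith)
    have h2 : 0 ≤ 8 * N / ε := by positivity
    linarith
  have hB0 : 0 < B := by linarith
  have hε1 : ε ≤ 1 / 2 := by
    rw [hε]
    have : (1 : ℝ) ≤ 4 ^ b := one_le_pow₀ (by norm_num)
    gcongr
    linarith
  refine ⟨B / (2 * ε), ?_, (ε / 8) ^ b / 2, by positivity, ?_⟩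
  · rw [le_div_iff₀ (by positivity)]
    linarith
  intro V _ _ G hm
  set n : ℝ := (Fintype.card V : ℝ) with hn
  have hn1 : 1 ≤ n := by
    rw [hn]; exact_mod_cast Fintype.card_pos
  have hn0 : 0 < n := by linarith
  set m : ℝ := (G.edgeSet.ncard : ℝ) with hmdef
  have hpow : n ^ (1 + 1 / (b : ℝ)) = n * n ^ (1 / (b : ℝ)) := by
    rw [Real.rpow_add hn0, Real.rpow_one]
  have hroot1 : 1 ≤ n ^ (1 / (b : ℝ)) := Real.one_le_rpow hn1 (by positivity)
  have hrootb : (n ^ (1 / (b : ℝ))) ^ b = n := by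
    rw [← Real.rpow_natCast, ← Real.rpow_mul hn0.le, one_div_mul_cancel (by positivity),
      Real.rpow_one]
  have hδ : B * n ^ (1 / (b : ℝ)) ≤ ε * (2 * m) / n := by
    rw [le_div_iff₀ hn0]
    rw [hpow, div_mul_eq_mul_div, div_le_iff₀ (by positivity)] at hm
    linarith
  refine mul_card_sq_le_labelledCopyCount (G := G) (N := N) (T := T) (B := B)
    (δ := ε * (2 * m) / n) ha hb le_rfl hε0 ?_ hT4 ?_ ?_ ?_ ?_ ?_ ?_
  · rw [hε]; field_simp; norm_num
  · rw [hT]; linarith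
  · rw [hB]
    linarith [show 0 ≤ 8 * N / ε by positivity]
  · rw [hB]
    linarith [show 0 ≤ T ^ 3 by positivity]
  · rw [sum_vdeg_eq, mul_div_cancel₀ _ hn0.ne']
  · exact (le_mul_of_one_le_right hB0.le hroot1).trans hδ
  · have := pow_le_pow_left₀ (by positivity) hδ b
    rwa [mul_pow, hrootb, mul_comm] at this

end

/-! ### Sampling edges -/

section

section Sampling

lemma choose_sub_mul_pow_le {m r : ℕ} (hrm : r ≤ m) (k : ℕ) (hk : k ≤ r) :
    (m - k).choose (r - k) * m ^ k ≤ m.choose r * r ^ k := by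
  induction k with
  | zero => simp
  | succ k ih =>
    have ih := ih (by omega)
    obtain ⟨p, hp⟩ : ∃ p, m - k = p + 1 := ⟨m - k - 1, by omega⟩
    obtain ⟨q, hq⟩ : ∃ q, r - k = q + 1 := ⟨r - k - 1, by omega⟩
    rw [hp, hq] at ih
    rw [show m - (k + 1) = p by omega, show r - (k + 1) = q by omega]
    have h1 : (p + 1) * p.choose q = (p + 1).choose (q + 1) * (q + 1) :=
      Nat.add_one_mul_choose_eq p q
    have h2 : (q + 1) * m ≤ r * (p + 1) := by
      obtain rfl : m = p + 1 + k := by omega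
      obtain rfl : r = q + 1 + k := by omega
      have : q ≤ p := by omega
      nlinarith [Nat.mul_le_mul_right k this]
    refine Nat.le_of_mul_le_mul_left (c := p + 1) ?_ (Nat.succ_pos p)
    calc (p + 1) * (p.choose q * m ^ (k + 1))
        = ((p + 1) * p.choose q) * m * m ^ k := by ring
      _ = (p + 1).choose (q + 1) * m ^ k * ((q + 1) * m) := by rw [h1]; ring
      _ ≤ m.choose r * r ^ k * (r * (p + 1)) := Nat.mul_le_mul ih h2
      _ = (p + 1) * (m.choose r * r ^ (k + 1)) := by ring

lemma card_powersetCard_superset_le {α : Type*} [DecidableEq α] {A E : Finset α} (hA : A ⊆ E)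
    (r : ℕ) :
    #{E' ∈ E.powersetCard r | A ⊆ E'} ≤ (#E - #A).choose (r - #A) := by
  rw [← Finset.card_sdiff_of_subset hA, ← Finset.card_powersetCard]
  refine Finset.card_le_card_of_injOn (fun E' => E' \ A) ?_ ?_
  · intro E' hE'
    obtain ⟨hE', hAE'⟩ := Finset.mem_filter.1 hE'
    obtain ⟨hsub, hcard⟩ := Finset.mem_powersetCard.1 hE'
    refine Finset.mem_coe.2 (Finset.mem_powersetCard.2 ⟨Finset.sdiff_subset_sdiff hsub le_rfl, ?_⟩)
    rw [Finset.card_sdiff_of_subset hAE', hcard]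
  · intro E₁ h₁ E₂ h₂ h
    have h₁ := (Finset.mem_filter.1 h₁).2
    have h₂ := (Finset.mem_filter.1 h₂).2
    have h : E₁ \ A = E₂ \ A := h
    rw [← Finset.sdiff_union_of_subset h₁, h, Finset.sdiff_union_of_subset h₂]

/-- Double counting of the pairs formed by a set of a family and an `r`-set containing it. -/
lemma choose_mul_le_card_mul {α ι : Type*} [DecidableEq α] [Fintype ι] {E : Finset α}
    {A : ι → Finset α} {k r : ℕ} {X : ℝ} (hAE : ∀ f, A f ⊆ E) (hA : ∀ f, #(A f) = k)
    (hX : ∀ E' ∈ E.powersetCard r, X ≤ #{f | A f ⊆ E'}) :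
    ((#E).choose r : ℝ) * X ≤ Fintype.card ι * ((#E - k).choose (r - k) : ℕ) := by
  have h2 : ((#E).choose r : ℝ) * X ≤ ∑ E' ∈ E.powersetCard r, (#{f | A f ⊆ E'} : ℝ) := by
    rw [← Finset.card_powersetCard, ← nsmul_eq_mul]
    exact Finset.card_nsmul_le_sum _ _ _ hX
  have h3 : ∑ E' ∈ E.powersetCard r, #{f | A f ⊆ E'} =
      ∑ f, #{E' ∈ E.powersetCard r | A f ⊆ E'} :=
    Finset.sum_card_bipartiteAbove_eq_sum_card_bipartiteBelow fun E' f => A f ⊆ E'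
  have h4 : ∑ f, #{E' ∈ E.powersetCard r | A f ⊆ E'} ≤
      Fintype.card ι * (#E - k).choose (r - k) := by
    rw [← Finset.card_univ, ← smul_eq_mul]
    refine Finset.sum_le_card_nsmul _ _ _ fun f _ => ?_
    rw [← hA f]
    exact card_powersetCard_superset_le (hAE f) r
  refine h2.trans ?_
  exact_mod_cast h3.le.trans h4

variable {V W : Type*} [Fintype W]

/-- The edges of a copy of `H`. -/
noncomputable def copyEdges {G : SimpleGraph V} {H : SimpleGraph W} (f : SimpleGraph.Copy H G) :
    Finset (Sym2 V) :=
  H.edgeFinset.image (Sym2.map f)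

lemma card_copyEdges {G : SimpleGraph V} {H : SimpleGraph W} (f : SimpleGraph.Copy H G) :
    #(copyEdges f) = H.edgeSet.ncard := by
  unfold copyEdges
  rw [Finset.card_image_of_injective _ (Sym2.map.injective (f := f) f.injective),
    ← SimpleGraph.coe_edgeFinset, Set.ncard_coe_finset]

variable [Fintype V]

lemma copyEdges_subset {G : SimpleGraph V} {H : SimpleGraph W} (f : SimpleGraph.Copy H G) :
    copyEdges f ⊆ G.edgeFinset := by
  intro e he
  obtain ⟨e', he', rfl⟩ := Finset.mem_image.1 he
  rw [SimpleGraph.mem_edgeFinset] at he' ⊢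
  exact SimpleGraph.Hom.map_mem_edgeSet f.toHom he'

/-- Copies in the spanning subgraph with edge set `E'` are copies all of whose edges are in `E'`. -/
lemma labelledCopyCount_fromEdgeSet_le (G : SimpleGraph V) (H : SimpleGraph W)
    [Fintype (SimpleGraph.Copy H G)] {E' : Finset (Sym2 V)} (hE' : E' ⊆ G.edgeFinset) :
    (SimpleGraph.fromEdgeSet (E' : Set (Sym2 V))).labelledCopyCount H ≤
      #{f : SimpleGraph.Copy H G | copyEdges f ⊆ E'} := by
  have hle : SimpleGraph.fromEdgeSet (E' : Set (Sym2 V)) ≤ G := by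
    intro u v huv
    rw [SimpleGraph.fromEdgeSet_adj] at huv
    exact SimpleGraph.mem_edgeFinset.1 (hE' huv.1)
  let _ : Fintype (SimpleGraph.Copy H (SimpleGraph.fromEdgeSet (E' : Set (Sym2 V)))) :=
    Fintype.ofFinite _
  rw [labelledCopyCount_eq_natCard, Nat.card_eq_fintype_card, ← Finset.card_univ]
  refine Finset.card_le_card_of_injOn (fun f => (SimpleGraph.Copy.ofLE _ _ hle).comp f) ?_ ?_
  · intro f _
    refine Finset.mem_coe.2 (Finset.mem_filter.2 ⟨Finset.mem_univ _, fun e he => ?_⟩)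
    obtain ⟨e', he', rfl⟩ := Finset.mem_image.1 he
    induction e' with
    | h x y =>
      rw [SimpleGraph.mem_edgeFinset, SimpleGraph.mem_edgeSet] at he'
      exact ((SimpleGraph.fromEdgeSet_adj _).1 (f.toHom.map_rel he')).1
  · intro f _ f' _ h
    ext x
    have := DFunLike.congr_fun h x
    simpa using this

/-- Averaging over the spanning subgraphs of `G` with `r` edges: a lower bound for the number of
copies of `H` in each of them scales up to `G`. -/
lemma mul_pow_le_labelledCopyCount (G : SimpleGraph V) (H : SimpleGraph W) {r : ℕ}
    {X : ℝ} (hX : 0 < X) (hr : r ≤ G.edgeSet.ncard)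
    (h : ∀ G' : SimpleGraph V, G'.edgeSet.ncard = r → X ≤ G'.labelledCopyCount H) :
    X * (G.edgeSet.ncard : ℝ) ^ H.edgeSet.ncard ≤
      G.labelledCopyCount H * (r : ℝ) ^ H.edgeSet.ncard := by
  obtain ⟨hfin⟩ := nonempty_fintype (SimpleGraph.Copy H G)
  set k := H.edgeSet.ncard with hk
  set m := G.edgeSet.ncard with hm
  have hcard : #G.edgeFinset = m := by
    rw [hm, ← SimpleGraph.coe_edgeFinset, Set.ncard_coe_finset]
  have hsub : ∀ E' ∈ G.edgeFinset.powersetCard r,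
      X ≤ #{f : SimpleGraph.Copy H G | copyEdges f ⊆ E'} := by
    intro E' hE'
    obtain ⟨hE's, hE'c⟩ := Finset.mem_powersetCard.1 hE'
    refine (h (SimpleGraph.fromEdgeSet (E' : Set (Sym2 V))) ?_).trans
      (Nat.cast_le.2 (labelledCopyCount_fromEdgeSet_le G H hE's))
    rw [SimpleGraph.edgeSet_fromEdgeSet, sdiff_eq_left.2, Set.ncard_coe_finset, hE'c]
    refine Set.disjoint_left.2 fun e he hd => ?_
    exact G.not_isDiag_of_mem_edgeSet (SimpleGraph.mem_edgeFinset.1 (hE's he)) hd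
  have hne : (G.edgeFinset.powersetCard r).Nonempty :=
    Finset.powersetCard_nonempty.2 (hcard ▸ hr)
  -- The number `r - k` must not be truncated: as `X` is positive, some `r`-set contains a copy.
  have hkr : k ≤ r := by
    obtain ⟨E', hE'⟩ := hne
    obtain ⟨f, hf⟩ : ({f : SimpleGraph.Copy H G | copyEdges f ⊆ E'} : Finset _).Nonempty := by
      rw [← Finset.card_pos]
      exact_mod_cast hX.trans_le (hsub E' hE')
    rw [hk, ← card_copyEdges f, ← (Finset.mem_powersetCard.1 hE').2]
    exact Finset.card_le_card (Finset.mem_filter.1 hf).2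
  have h1 : (m.choose r : ℝ) * X ≤ G.labelledCopyCount H * ((m - k).choose (r - k) : ℕ) := by
    rw [labelledCopyCount_eq_natCard, Nat.card_eq_fintype_card, ← hcard]
    exact choose_mul_le_card_mul (fun f => copyEdges_subset f) (fun f => card_copyEdges f) hsub
  have h5 : ((m - k).choose (r - k) : ℝ) * m ^ k ≤ m.choose r * r ^ k := by
    exact_mod_cast choose_sub_mul_pow_le hr k hkr
  have h6 : (0 : ℝ) < m.choose r := by exact_mod_cast Nat.choose_pos hr
  refine le_of_mul_le_mul_left ?_ h6
  calc (m.choose r : ℝ) * (X * m ^ k) = m.choose r * X * m ^ k := by ring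
    _ ≤ G.labelledCopyCount H * ((m - k).choose (r - k) : ℕ) * m ^ k := by gcongr
    _ = G.labelledCopyCount H * (((m - k).choose (r - k) : ℕ) * m ^ k) := by ring
    _ ≤ G.labelledCopyCount H * (m.choose r * r ^ k) := by gcongr
    _ = _ := by ring

/-- A subgraph isomorphic to `H` is the image of a bounded number of labelled copies of `H`. -/
lemma labelledCopyCount_le_mul_copyCount (G : SimpleGraph V) (H : SimpleGraph W) :
    G.labelledCopyCount H ≤ Fintype.card W ^ Fintype.card W * G.copyCount H := by
  obtain ⟨hfin⟩ := nonempty_fintype (SimpleGraph.Copy H G)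
  have hcopy : G.copyCount H =
      #((Finset.univ : Finset (SimpleGraph.Copy H G)).image SimpleGraph.Copy.toSubgraph) := by
    rw [SimpleGraph.copyCount_eq_card_image_copyToSubgraph]
    congr!
  rw [hcopy, labelledCopyCount_eq_natCard, Nat.card_eq_fintype_card, ← Finset.card_univ]
  refine Finset.card_le_mul_card_image _ _ fun G' hG' => ?_
  obtain ⟨f₀, -, rfl⟩ := Finset.mem_image.1 hG'
  have hmem : ∀ f : SimpleGraph.Copy H G, f.toSubgraph = f₀.toSubgraph →
      ∀ x, f x ∈ Finset.univ.map f₀.toEmbedding := by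
    intro f hf x
    have h1 : f x ∈ f.toSubgraph.verts := by simp
    rw [hf] at h1
    obtain ⟨y, -, hy⟩ := h1
    exact Finset.mem_map.2 ⟨y, Finset.mem_univ _, hy⟩
  have h2 : #({f : SimpleGraph.Copy H G | f.toSubgraph = f₀.toSubgraph} : Finset _) ≤
      #(Fintype.piFinset fun _ : W => Finset.univ.map f₀.toEmbedding) := by
    refine Finset.card_le_card_of_injOn (fun f => ⇑f) ?_ ?_
    · intro f hf
      exact Finset.mem_coe.2 (Fintype.mem_piFinset.2 (hmem f (Finset.mem_filter.1 hf).2))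
    · exact fun f _ f' _ h => DFunLike.coe_injective h
  refine h2.trans (le_of_eq ?_)
  rw [Fintype.card_piFinset, Finset.prod_const, Finset.card_map, Finset.card_univ]

end Sampling

/-- The distance from the first endpoint along the paths of the theta graph. -/
def thetaRank (a b : ℕ) : ThetaVertex a b → ℕ
  | Sum.inl e => if e = 0 then 0 else b
  | Sum.inr (_, k) => k + 1

lemma thetaRank_thetaPathVertex {a b : ℕ} (i : Fin a) {j : ℕ} (hj : j ≤ b) :
    thetaRank a b (thetaPathVertex a b i j) = j := by
  unfold thetaPathVertex
  split_ifs with h1 h2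
  · simp [thetaRank, h1]
  · simp [thetaRank]
    omega
  · simp [thetaRank]
    omega

lemma mul_le_ncard_edgeSet_thetaGraph {a b : ℕ} (hb : 2 ≤ b) :
    a * b ≤ (thetaGraph a b).edgeSet.ncard := by
  let φ : Fin a × Fin b → Sym2 (ThetaVertex a b) :=
    fun p => s(thetaPathVertex a b p.1 p.2, thetaPathVertex a b p.1 (p.2 + 1))
  have hφ : Function.Injective φ := by
    rintro ⟨i, j⟩ ⟨i', j'⟩ h
    have hr1 := thetaRank_thetaPathVertex (a := a) (b := b) i (j := j) (by omega)
    have hr2 := thetaRank_thetaPathVertex (a := a) (b := b) i (j := j + 1) (by omega)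
    have hr3 := thetaRank_thetaPathVertex (a := a) (b := b) i' (j := j') (by omega)
    have hr4 := thetaRank_thetaPathVertex (a := a) (b := b) i' (j := j' + 1) (by omega)
    rcases Sym2.eq_iff.1 h with ⟨h1, h2⟩ | ⟨h1, h2⟩ <;> dsimp only at h1 h2
    · have hj : (j : ℕ) = j' := by rw [← hr1, h1, hr3]
      obtain rfl : j = j' := Fin.ext hj
      suffices i = i' by rw [this]
      rcases Nat.eq_zero_or_pos j with h0 | h0
      · rw [thetaPathVertex_interior i (by omega) (by omega),
          thetaPathVertex_interior i' (by omega) (by omega)] at h2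
        simpa using h2
      · rw [thetaPathVertex_interior i (by omega) (by omega),
          thetaPathVertex_interior i' (by omega) (by omega)] at h1
        simpa using h1
    · have e1 : (j : ℕ) = j' + 1 := by rw [← hr1, h1, hr4]
      have e2 : (j : ℕ) + 1 = j' := by rw [← hr2, h2, hr3]
      omega
  have hmem : ∀ p, φ p ∈ (thetaGraph a b).edgeSet := by
    rintro ⟨i, j⟩
    refine (SimpleGraph.mem_edgeSet _).2 ((SimpleGraph.fromRel_adj _ _ _).2 ⟨fun h => ?_, ?_⟩)
    · have h := congrArg (thetaRank a b) h
      rw [thetaRank_thetaPathVertex i (by omega), thetaRank_thetaPathVertex i (by omega)] at h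
      omega
    · exact Or.inl ⟨i, j, rfl, rfl⟩
  have h1 : (Set.range φ).ncard ≤ (thetaGraph a b).edgeSet.ncard :=
    Set.ncard_le_ncard (Set.range_subset_iff.2 hmem) (Set.toFinite _)
  rw [← Set.image_univ, Set.ncard_image_of_injective _ hφ, Set.ncard_univ] at h1
  simpa using h1

end

end ThetaSupersaturation

theorem mainTheorem6 (a b : ℕ) (ha : 2 ≤ a) (hb : 2 ≤ b) :
    ∃ C : ℝ, 0 < C ∧ ∃ c : ℝ, 0 < c ∧
      ∀ (V : Type*) [Fintype V] [Nonempty V] (G : SimpleGraph V) (n m : ℕ),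
        Fintype.card V = n → G.edgeSet.ncard = m →
        C * (n : ℝ) ^ (1 + 1 / (b : ℝ)) ≤ (m : ℝ) →
        c * ((m : ℝ) ^ (a * b) * (n : ℝ) ^ (2 - (a : ℤ) * ((b : ℤ) + 1))) ≤
          (G.copyCount (thetaGraph a b) : ℝ) := by
  obtain ⟨C, hC, c, hc, hcore⟩ :=
    ThetaSupersaturation.exists_quadratic_labelledCopyCount (a := a) (b := b) ha (by omega)
  have hC0 : 0 < C := by linarith
  obtain ⟨w, hw⟩ : ∃ w, w = Fintype.card (ThetaVertex a b) := ⟨_, rfl⟩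
  have hw0 : 0 < w := hw ▸ Fintype.card_pos_iff.2 ⟨Sum.inl 0⟩
  refine ⟨C, hC0, c / ((2 * C) ^ (a * b) * w ^ w), by positivity, ?_⟩
  intro V _ _ G n m hn hm hmn
  have hn1 : (1 : ℝ) ≤ n := by
    rw [← hn]; exact_mod_cast Fintype.card_pos
  have hn0 : (0 : ℝ) < n := by linarith
  set q : ℝ := (n : ℝ) ^ (1 + 1 / (b : ℝ)) with hq
  have hq1 : 1 ≤ q := Real.one_le_rpow hn1 (by positivity)
  have hCq1 : 1 ≤ C * q := by nlinarith
  set r : ℕ := ⌈C * q⌉₊ with hr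
  have hr_ge : C * q ≤ r := Nat.le_ceil _
  have hr_le : (r : ℝ) ≤ 2 * C * q := by
    have := Nat.ceil_lt_add_one (show 0 ≤ C * q by positivity)
    linarith
  have hrm : r ≤ m := Nat.ceil_le.2 hmn
  have hr0 : (0 : ℝ) < r := by linarith
  have hXcopy := ThetaSupersaturation.labelledCopyCount_le_mul_copyCount G (thetaGraph a b)
  rw [← hw, ← Nat.cast_le (α := ℝ)] at hXcopy
  push_cast at hXcopy
  have hsample := ThetaSupersaturation.mul_pow_le_labelledCopyCount G (thetaGraph a b) (r := r)
    (X := c * (n : ℝ) ^ 2) (by positivity) (by rw [hm]; exact hrm) fun G' hG' => by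
      have := hcore V G' (by rw [hn, hG']; exact hr_ge)
      rwa [hn] at this
  rw [hm] at hsample
  generalize (G.labelledCopyCount (thetaGraph a b) : ℝ) = X at hXcopy hsample
  generalize (G.copyCount (thetaGraph a b) : ℝ) = Y at hXcopy ⊢
  have hX0 : 0 ≤ X := by
    by_contra! h
    have h3 : 0 < c * (n : ℝ) ^ 2 * (m : ℝ) ^ (thetaGraph a b).edgeSet.ncard := by
      have : (0 : ℝ) < m := hr0.trans_le (by exact_mod_cast hrm)
      positivity
    have h4 := mul_nonpos_of_nonpos_of_nonneg h.le
      (show 0 ≤ (r : ℝ) ^ (thetaGraph a b).edgeSet.ncard by positivity)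
    linarith
  -- The theta graph has at least `a * b` edges, and `r ≤ m`.
  have h1 : c * (n : ℝ) ^ 2 * (m : ℝ) ^ (a * b) ≤ X * (r : ℝ) ^ (a * b) := by
    obtain ⟨k, hk⟩ := Nat.exists_eq_add_of_le
      (ThetaSupersaturation.mul_le_ncard_edgeSet_thetaGraph (a := a) hb)
    rw [hk, pow_add, pow_add] at hsample
    have hrk : (0 : ℝ) < (r : ℝ) ^ k := by positivity
    refine le_of_mul_le_mul_right ?_ hrk
    have h2 : (r : ℝ) ^ k ≤ (m : ℝ) ^ k :=
      pow_le_pow_left₀ hr0.le (by exact_mod_cast hrm) k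
    calc c * (n : ℝ) ^ 2 * (m : ℝ) ^ (a * b) * (r : ℝ) ^ k
        ≤ c * (n : ℝ) ^ 2 * (m : ℝ) ^ (a * b) * (m : ℝ) ^ k := by gcongr
      _ ≤ _ := by linarith
  have hqpow : q ^ (a * b) = (n : ℝ) ^ (a * (b + 1)) := by
    rw [hq, ← Real.rpow_natCast, ← Real.rpow_mul hn0.le, ← Real.rpow_natCast]
    congr 1
    push_cast
    have : (b : ℝ) ≠ 0 := by positivity
    field_simp
  have h2 : X * (r : ℝ) ^ (a * b) ≤ X * ((2 * C) ^ (a * b) * (n : ℝ) ^ (a * (b + 1))) := by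
    rw [← hqpow, ← mul_pow]
    gcongr
  have hz : (n : ℝ) ^ (2 - (a : ℤ) * ((b : ℤ) + 1)) = (n : ℝ) ^ 2 / (n : ℝ) ^ (a * (b + 1)) := by
    rw [zpow_sub₀ hn0.ne']
    norm_cast
  rw [hz, div_mul_eq_mul_div, div_le_iff₀ (by positivity), ← mul_div_assoc, ← mul_div_assoc,
    div_le_iff₀ (by positivity)]
  calc c * ((m : ℝ) ^ (a * b) * (n : ℝ) ^ 2) = c * (n : ℝ) ^ 2 * (m : ℝ) ^ (a * b) := by ring
    _ ≤ X * ((2 * C) ^ (a * b) * (n : ℝ) ^ (a * (b + 1))) := h1.trans h2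
    _ ≤ w ^ w * Y *
        ((2 * C) ^ (a * b) * (n : ℝ) ^ (a * (b + 1))) := by gcongr
    _ = _ := by ring
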